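/- Let $\mathcal K$ be the compact operators on $\ell^2(\mathbb N)$ and let $\mathrm{Cu}(C[0,1])=(C[0,1]\otimes\mathcal K)_+/\!\sim$ be the Cuntz semigroup of $C[0,1]$, where $C[0,1]\otimes\mathcal K=C([0,1],\mathcal K)$, $a\precsim b$ means that $\|r_nbr_n^*-a\|\to0$ for some sequence $(r_n)$ in $C([0,1],\mathcal K)$, $a\sim b$ means $a\precsim b$ and $b\precsim a$, and $[a]\le[b]$ means $a\precsim b$. For $x=[a]$ let $f_x\colon[0,1]\to\overline{\mathbb N}=\{0,1,2,\dots,\infty\}$, $f_x(t)=\mathrm{rank}(a(t))$, be its rank function, which is lower semicontinuous. Write $x\ll y$ if, whenever $(z_n)$ is an increasing sequence in $\mathrm{Cu}(C[0,1])$ with supremum $z$ and $y\le z$, there is $n_0$ with $x\le z_{n_0}$; call $x$ compact if $x\ll x$, and noncompact otherwise. Let $x,y\in\mathrm{Cu}(C[0,1])$. The following are equivalent: 1. $x\ll y$. 2. For every $t\in[0,1]$ there are an open interval $U_t$ containing $t$ and a finite constant $c_t\in\mathbb N=\{0,1,2,\dots\}$ such that $f_x(s)\le c_t\le f_y(s)$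 for all $s\in U_t\cap[0,1]$. 3. There is a continuous function $g\colon[0,1]\to[0,\infty)$ such that $f_x(t)\le g(t)\le f_y(t)$ for all $t\in[0,1]$. If, moreover, $x$ or $y$ is compact, then $x\ll y$ if and only if $f_x\le f_y$ pointwise. Finally, if $y$ is noncompact and $x\ll y$, then a function $g$ as in (3) exists, and for every such $g$ there is a nonempty open interval $U\subset[0,1]$ such that $f_x(t)\le g(t)<f_y(t)$ for all $t\in U$. -/

import Mathlib

open Set Filter Topology

/-! ### Compact containment in ordered sets -/

/-- (Sequential) compact containment `x ≪ y`: whenever an increasing sequence has a supremum `s`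
with `y ≤ s`, some term of the sequence dominates `x`. -/
def CompactlyContained {S : Type*} [PartialOrder S] (x y : S) : Prop :=
  ∀ (z : ℕ → S) (s : S), Monotone z → IsLUB (range z) s → y ≤ s → ∃ n, x ≤ z n

/-- `x` is compact if `x ≪ x` (and noncompact otherwise). -/
def IsSeqCompactElement {S : Type*} [PartialOrder S] (x : S) : Prop :=
  CompactlyContained x x

/-! ### Cuntz comparison of positive elements of a C*-algebra -/

/-- The positive elements of a C*-algebra: the elements of the form `c* c`. -/
structure PositiveElement (A : Type*) [NonUnitalCStarAlgebra A] where
  val : A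
  exists_eq_star_mul_self : ∃ c : A, val = star c * c

/-- Cuntz subequivalence: `r n * b * (r n)* → a` in norm for some sequence `r`. -/
def CuntzSubequivalent {A : Type*} [NonUnitalCStarAlgebra A] (a b : A) : Prop :=
  ∃ r : ℕ → A, Tendsto (fun n => ‖r n * b * star (r n) - a‖) atTop (𝓝 0)

theorem cuntzSubequivalent_iff {A : Type*} [NonUnitalCStarAlgebra A] (a b : A) :
    CuntzSubequivalent a b ↔ ∀ ε : ℝ, 0 < ε → ∃ r : A, ‖r * b * star r - a‖ < ε := by
  constructor
  · rintro ⟨r, hr⟩ ε hε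
    obtain ⟨n, hn⟩ := (hr.eventually (gt_mem_nhds hε)).exists
    exact ⟨r n, hn⟩
  · intro h
    choose r hr using fun n : ℕ => h (1 / ((n : ℝ) + 1)) (by positivity)
    exact ⟨r, squeeze_zero (fun _ => norm_nonneg _) (fun n => (hr n).le)
      tendsto_one_div_add_atTop_nhds_zero_nat⟩

theorem CuntzSubequivalent.refl {A : Type*} [NonUnitalCStarAlgebra A] (a : A) :
    CuntzSubequivalent a a := by
  let _ : PartialOrder A := CStarAlgebra.spectralOrder A
  have : StarOrderedRing A := CStarAlgebra.spectralOrderedRing A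
  have hu := CStarAlgebra.increasingApproximateUnit A
  have := hu.neBot
  rw [cuntzSubequivalent_iff]
  intro ε hε
  have h1 := Metric.tendsto_nhds.1 (hu.tendsto_mul_left a) (ε / 2) (by positivity)
  have h2 := Metric.tendsto_nhds.1 (hu.tendsto_mul_right a) (ε / 2) (by positivity)
  obtain ⟨r, hr1, hr2, hr3, hr4⟩ :=
    (h1.and (h2.and (hu.eventually_star_eq.and hu.eventually_norm))).exists
  refine ⟨r, ?_⟩
  rw [dist_eq_norm] at hr1 hr2
  rw [hr3]
  have e : r * a * r - a = r * (a * r - a) + (r * a - a) := by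
    rw [mul_sub, mul_assoc]; abel
  rw [e]
  calc ‖r * (a * r - a) + (r * a - a)‖ ≤ ‖r‖ * ‖a * r - a‖ + ‖r * a - a‖ :=
        (norm_add_le _ _).trans (add_le_add_left (norm_mul_le _ _) _)
    _ ≤ 1 * ‖a * r - a‖ + ‖r * a - a‖ := by gcongr
    _ < ε := by linarith

theorem CuntzSubequivalent.trans {A : Type*} [NonUnitalCStarAlgebra A] {a b c : A}
    (hab : CuntzSubequivalent a b) (hbc : CuntzSubequivalent b c) : CuntzSubequivalent a c := by
  rw [cuntzSubequivalent_iff] at *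
  intro ε hε
  obtain ⟨r, hr⟩ := hab (ε / 2) (by positivity)
  obtain ⟨s, hs⟩ := hbc (ε / 2 / (‖r‖ * ‖r‖ + 1)) (by positivity)
  refine ⟨r * s, ?_⟩
  have e : r * s * c * star (r * s) - a
      = r * (s * c * star s - b) * star r + (r * b * star r - a) := by
    rw [star_mul, mul_sub, sub_mul]
    simp only [mul_assoc]
    abel
  rw [e]
  have h1 : ‖r * (s * c * star s - b) * star r‖ ≤ (‖r‖ * ‖r‖) * ‖s * c * star s - b‖ := by
    calc _ ≤ ‖r‖ * ‖s * c * star s - b‖ * ‖star r‖ :=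
          (norm_mul_le _ _).trans (mul_le_mul_of_nonneg_right (norm_mul_le _ _) (norm_nonneg _))
      _ = _ := by rw [norm_star]; ring
  have h2 : (‖r‖ * ‖r‖) * ‖s * c * star s - b‖ ≤ ε / 2 := by
    rw [lt_div_iff₀ (by positivity)] at hs
    nlinarith [norm_nonneg (s * c * star s - b)]
  linarith [norm_add_le (r * (s * c * star s - b) * star r) (r * b * star r - a)]

/-- Positive elements, preordered by Cuntz subequivalence. -/
instance PositiveElement.instPreorder (A : Type*) [NonUnitalCStarAlgebra A] :
    Preorder (PositiveElement A) where
  le a b := CuntzSubequivalent a.val b.val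
  le_refl a := CuntzSubequivalent.refl a.val
  le_trans _ _ _ := CuntzSubequivalent.trans

/-- Cuntz equivalence classes of positive elements of `A`, ordered by Cuntz subequivalence of
representatives. -/
abbrev CuntzClass (A : Type*) [NonUnitalCStarAlgebra A] : Type _ :=
  Antisymmetrization (PositiveElement A) (· ≤ ·)

/-! ### The C*-algebra of compact operators and the Cuntz semigroup of `C(X)` -/

/-- The separable infinite-dimensional Hilbert space `ℓ²(ℕ)`. -/
abbrev HilbertL2 : Type := lp (fun _ : ℕ => ℂ) 2

/-- The Hilbert space adjoint of a compact operator is compact. -/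
theorem isCompactOperator_star {T : HilbertL2 →L[ℂ] HilbertL2} (hT : IsCompactOperator T) :
    IsCompactOperator (star T : HilbertL2 →L[ℂ] HilbertL2) := by
  have hK : IsCompactOperator (T * star T : HilbertL2 →L[ℂ] HilbertL2) :=
    hT.comp_clm (star T)
  have key : ∀ x y : HilbertL2, ‖x‖ ≤ 1 → ‖y‖ ≤ 1 →
      ‖star T x - star T y‖ ^ 2 ≤ 2 * ‖(T * star T) x - (T * star T) y‖ := by
    intro x y hx hy
    rw [← map_sub, ← map_sub]
    have h1 : ‖star T (x - y)‖ ^ 2 = RCLike.re (inner ℂ ((T * star T) (x - y)) (x - y)) := by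
      rw [ContinuousLinearMap.star_eq_adjoint, ← inner_self_eq_norm_sq (𝕜 := ℂ),
        ContinuousLinearMap.adjoint_inner_right]
      rfl
    rw [h1]
    refine (RCLike.re_le_norm _).trans ((norm_inner_le_norm _ _).trans ?_)
    have : ‖x - y‖ ≤ 2 := (norm_sub_le _ _).trans (by linarith)
    nlinarith [norm_nonneg ((T * star T) (x - y))]
  refine (isCompactOperator_iff_isCompact_closure_image_closedBall
    (star T : HilbertL2 →L[ℂ] HilbertL2).toLinearMap one_pos).2 ?_
  have hK' : TotallyBounded ((T * star T) '' Metric.closedBall 0 1) :=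
    ((hK.isCompact_closure_image_closedBall 1).totallyBounded).subset subset_closure
  refine TotallyBounded.isCompact_of_isClosed (TotallyBounded.closure ?_) isClosed_closure
  classical
  rw [Metric.totallyBounded_iff]
  intro ε hε
  obtain ⟨t, hts, htf, htc⟩ := Metric.finite_approx_of_totallyBounded hK' (ε ^ 2 / 2)
    (by positivity)
  obtain ⟨u, hu, huf, rfl⟩ := (htf.exists_finset_coe.elim fun t' ht' => by
    subst ht'
    obtain ⟨u, hu, hu'⟩ := Finset.subset_set_image_iff.1 hts
    exact ⟨(u : Set HilbertL2), hu, u.finite_toSet, by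
      rw [← hu']; simp⟩ : ∃ u : Set HilbertL2, u ⊆ Metric.closedBall 0 1 ∧ u.Finite ∧
        (T * star T) '' u = t)
  refine ⟨(star T : HilbertL2 →L[ℂ] HilbertL2) '' u, huf.image _, ?_⟩
  rintro _ ⟨x, hx, rfl⟩
  have := htc ⟨x, hx, rfl⟩
  simp only [mem_iUnion, exists_prop, mem_image, exists_exists_and_eq_and, Metric.mem_ball,
    dist_eq_norm] at this ⊢
  obtain ⟨y, hy, hxy⟩ := this
  refine ⟨y, hy, ?_⟩
  have h := key x y (by simpa using hx) (by simpa using hu hy)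
  have h' : ‖star T x - star T y‖ ^ 2 < ε ^ 2 := by linarith
  exact lt_of_pow_lt_pow_left₀ 2 hε.le h'

/-- The C*-algebra `𝒦` of compact operators on `ℓ²(ℕ)`. -/
def compactOperators : NonUnitalStarSubalgebra ℂ (HilbertL2 →L[ℂ] HilbertL2) where
  carrier := {T | IsCompactOperator T}
  add_mem' := fun ha hb => ha.add hb
  zero_mem' := isCompactOperator_zero
  mul_mem' := fun {_ b} ha _ => ha.comp_clm b
  smul_mem' := fun c _ ha => ha.smul c
  star_mem' := fun ha => isCompactOperator_star ha

instance compactOperators_isClosed :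
    IsClosed (compactOperators : Set (HilbertL2 →L[ℂ] HilbertL2)) :=
  isClosed_setOfPred_isCompactOperator

/-- The stabilization `C(X) ⊗ 𝒦` of `C(X)`, for `X` compact, realised in the standard way as the
C*-algebra `C(X, 𝒦)` of norm-continuous functions (`f ⊗ k` being the function `t ↦ f t • k`). -/
abbrev StableContinuousFunctions (X : Type*) [TopologicalSpace X] [CompactSpace X] : Type _ :=
  C(X, compactOperators)

/-- The Cuntz semigroup `Cu(C(X)) = (C(X) ⊗ 𝒦)₊ / ∼` with its order. -/
abbrev CuC (X : Type*) [TopologicalSpace X] [CompactSpace X] : Type _ :=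
  CuntzClass (StableContinuousFunctions X)

/-! ### Rank functions -/

/-- The rank (dimension of the range) of an operator, in `{0, 1, 2, …, ∞}`. -/
noncomputable def operatorRank (T : HilbertL2 →L[ℂ] HilbertL2) : ℕ∞ :=
  Cardinal.toENat (LinearMap.rank T.toLinearMap)

theorem natCast_le_operatorRank_iff (T : HilbertL2 →L[ℂ] HilbertL2) (n : ℕ) :
    (n : ℕ∞) ≤ operatorRank T ↔
      ∃ v : Fin n → HilbertL2, LinearIndependent ℂ (fun i => T (v i)) := by
  rw [operatorRank, Cardinal.natCast_le_toENat, LinearMap.rank, Module.le_rank_iff]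
  constructor
  · rintro ⟨v, hv⟩
    choose w hw using fun i => (v i).2
    refine ⟨w, ?_⟩
    have := hv.map' (LinearMap.range T.toLinearMap).subtype (Submodule.ker_subtype _)
    rwa [show (LinearMap.range T.toLinearMap).subtype ∘ v = fun i => T (w i) from
      funext fun i => (hw i).symm] at this
  · rintro ⟨v, hv⟩
    refine ⟨fun i => ⟨T (v i), v i, rfl⟩, ?_⟩
    exact LinearIndependent.of_comp (LinearMap.range T.toLinearMap).subtype hv

theorem lowerSemicontinuous_operatorRank : LowerSemicontinuous operatorRank := by
  intro T m hm
  obtain ⟨k, rfl⟩ : ∃ k : ℕ, (k : ℕ∞) = m := ENat.ne_top_iff_exists.1 hm.ne_top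
  have hm' : ((k + 1 : ℕ) : ℕ∞) ≤ operatorRank T := by
    push_cast
    exact Order.add_one_le_of_lt hm
  obtain ⟨v, hv⟩ := (natCast_le_operatorRank_iff T (k + 1)).1 hm'
  have hc : Tendsto (fun S : HilbertL2 →L[ℂ] HilbertL2 => fun i => S (v i)) (𝓝 T)
      (𝓝 fun i => T (v i)) := by
    have : Continuous (fun S : HilbertL2 →L[ℂ] HilbertL2 => fun i => S (v i)) := by fun_prop
    exact this.tendsto T
  filter_upwards [hc.eventually hv.eventually] with S hS
  have h := (natCast_le_operatorRank_iff S (k + 1)).2 ⟨v, hS⟩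
  refine lt_of_lt_of_le ?_ h
  exact_mod_cast Nat.lt_succ_self k

theorem operatorRank_mul_mul_le (R T S : HilbertL2 →L[ℂ] HilbertL2) :
    operatorRank (R * T * S) ≤ operatorRank T := by
  refine ENat.forall_natCast_le_iff_le.1 fun n hn => ?_
  obtain ⟨v, hv⟩ := (natCast_le_operatorRank_iff _ n).1 hn
  exact (natCast_le_operatorRank_iff _ n).2
    ⟨fun i => S (v i), LinearIndependent.of_comp R.toLinearMap hv⟩

/-- The ordered set `Lsc(X, {0, 1, 2, …, ∞})` of lower semicontinuous functions, with the
pointwise order. -/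
abbrev LscENat (X : Type*) [TopologicalSpace X] : Type _ :=
  {f : X → ℕ∞ // LowerSemicontinuous f}

/-- The function `t ↦ rank (a t)`. -/
noncomputable def rankFunctionOf {X : Type*} [TopologicalSpace X] [CompactSpace X]
    (a : StableContinuousFunctions X) : LscENat X :=
  ⟨fun t => operatorRank (a t : HilbertL2 →L[ℂ] HilbertL2),
    lowerSemicontinuous_operatorRank.comp (continuous_subtype_val.comp a.continuous)⟩

theorem rankFunctionOf_mono {X : Type*} [TopologicalSpace X] [CompactSpace X]
    {a b : StableContinuousFunctions X} (h : CuntzSubequivalent a b) :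
    rankFunctionOf a ≤ rankFunctionOf b := by
  intro t
  obtain ⟨r, hr⟩ := h
  have h1 : Tendsto (fun n => r n * b * star (r n)) atTop (𝓝 a) :=
    tendsto_iff_norm_sub_tendsto_zero.2 hr
  have h2 : Tendsto (fun n => ((r n * b * star (r n)) t : HilbertL2 →L[ℂ] HilbertL2)) atTop
      (𝓝 (a t : HilbertL2 →L[ℂ] HilbertL2)) :=
    (continuous_subtype_val.tendsto _).comp
      (((ContinuousEvalConst.continuous_eval_const t).tendsto a).comp h1)
  by_contra! hlt
  obtain ⟨n, hn⟩ := (h2.eventually (lowerSemicontinuous_operatorRank _ _ hlt)).exists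
  exact absurd hn (not_lt.2 (operatorRank_mul_mul_le _ _ _))

/-- The map `θ : Cu(C(X)) → Lsc(X, {0, 1, 2, …, ∞})`, `θ([a])(t) = rank (a t)`. -/
noncomputable def rankFunction {X : Type*} [TopologicalSpace X] [CompactSpace X] (x : CuC X) :
    LscENat X :=
  Quotient.lift (fun a : PositiveElement (StableContinuousFunctions X) => rankFunctionOf a.val)
    (fun a b (h : a ≤ b ∧ b ≤ a) => le_antisymm (rankFunctionOf_mono h.1) (rankFunctionOf_mono h.2)) x

theorem rankFunction_mk {X : Type*} [TopologicalSpace X] [CompactSpace X]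
    (a : PositiveElement (StableContinuousFunctions X)) (t : X) :
    (rankFunction (toAntisymmetrization (· ≤ ·) a)).1 t =
      operatorRank (a.val t : HilbertL2 →L[ℂ] HilbertL2) :=
  rfl

/-- `g` is a continuous function with values in `[0, ∞)` lying between the rank functions of
`x` and `y`; the inequalities are read in `[0, ∞]`. -/
def LiesBetween {X : Type*} [TopologicalSpace X] [CompactSpace X] (x y : CuC X)
    (g : X → NNReal) : Prop :=
  Continuous g ∧ ∀ t : X, ((rankFunction x).1 t : ENNReal) ≤ (g t : ENNReal) ∧
    (g t : ENNReal) ≤ ((rankFunction y).1 t : ENNReal)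

/-! The rank function identifies the Cuntz semigroup of `C[0,1]` with the lower semicontinuous
functions into `ℕ∞`, as ordered sets (`rankFunction_le_iff`, `rankFunction_surjective`). Everything
else is then a statement about such functions.

The hard half is that `rank a(t) ≤ rank b(t)` for all `t` implies Cuntz subequivalence. For fixed
`t`, the `r` with `‖r b(t) r* - a(t)‖ < ε` form a nonempty set (`cuntzWitness_nonempty`) that is
path connected (`joinedIn_compactOperators`), and the condition is open in `(t, r)`. Over an
interval such a family has a continuous section (`exists_continuous_section`), which is the required
element of `C([0,1], 𝒦)`. Path connectedness is proved for `w = r*`, where the condition says that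
the form of `b` pulled back by `w` is within `ε` of the form of `a`. Compressing `w` to
finite-dimensional spectral subspaces makes it injective there. Connectedness of the unitary group
then yields a path along which the pulled-back form moves along a segment, and the condition is
convex in that form.

For `≪`, every `y` is the supremum of a sequence whose ranks are locally separated from `f_y` by
integer constants (`exists_locally_bounded_approximation`), so `x ≪ y` forces local separation of
`f_x` and `f_y`. The converse is compactness of `[0,1]`. Local constants glue to a continuous `g` by
a partition of unity, and `⌊g t⌋` recovers them. If `g` touched `f_y` everywhere, it would lie
between `y` and itself, making `y` compact. -/

/-! ### Paths of injective maps between finite-dimensional Hilbert spaces -/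

section FiniteDimensional

variable {F G : Type*} [NormedAddCommGroup F] [InnerProductSpace ℂ F]
  [NormedAddCommGroup G] [InnerProductSpace ℂ G]

/-- The unitary group of a finite-dimensional Hilbert space is path connected. -/
theorem joined_one_unitary [FiniteDimensional ℂ G] [CompleteSpace G] (U : unitary (G →L[ℂ] G)) :
    Joined 1 U := by
  have hfin : (spectrum ℂ (U : G →L[ℂ] G)).Finite := by
    rw [← AlgEquiv.spectrum_eq (Module.End.toContinuousLinearMap G).symm]
    exact Module.End.finite_spectrum _
  have hinj : InjOn (fun θ : ℝ => -Complex.exp (-(θ * Complex.I))) (Ioo 0 1) := by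
    intro s hs t ht hst
    have h : Complex.exp (-(s * Complex.I)) = Complex.exp (-(t * Complex.I)) := neg_injective hst
    have h' := congrArg Complex.re h
    simp only [← neg_mul, ← Complex.ofReal_neg, Complex.exp_ofReal_mul_I_re, Real.cos_neg] at h'
    have hpi := Real.pi_gt_three
    exact Real.injOn_cos ⟨hs.1.le, by linarith [hs.2]⟩ ⟨ht.1.le, by linarith [ht.2]⟩ h'
  -- A small rotation `z = exp(iθ)` moves the finite spectrum of `U` off `-1`. Then `z • U` is at
  -- distance less than `2` from both `1` and `U`, and unitaries that close are joined.
  obtain ⟨_, ⟨θ, hθ, rfl⟩, hθU⟩ :=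
    ((Ioo_infinite (zero_lt_one' ℝ)).image hinj).exists_notMem_finite hfin
  have hz : star (Complex.exp (θ * Complex.I)) * Complex.exp (θ * Complex.I) = 1 := by
    rw [Complex.star_def, ← Complex.exp_conj, ← Complex.exp_add]
    simp
  let z : unitary ℂ := ⟨Complex.exp (θ * Complex.I), hz, by rw [mul_comm]; exact hz⟩
  have hz1 : ‖(z : ℂ) - 1‖ < 2 := by
    have := Real.norm_exp_I_mul_ofReal_sub_one_le (x := θ)
    rw [mul_comm] at this
    refine this.trans_lt ?_
    rw [Real.norm_eq_abs, abs_of_pos hθ.1]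
    linarith [hθ.2]
  have hsmul : ((z • U : unitary (G →L[ℂ] G)) : G →L[ℂ] G) = (z : ℂ) • (U : G →L[ℂ] G) := rfl
  refine (Unitary.joined 1 (z • U) ?_).trans (Unitary.joined U (z • U) ?_).symm
  · refine (Unitary.norm_sub_one_lt_two_iff (z • U).2).2 fun h => hθU ?_
    rw [hsmul] at h
    have hzne : (z : ℂ) ≠ 0 := Complex.exp_ne_zero _
    have hm : Units.mk0 (z : ℂ) hzne • -Complex.exp (-(θ * Complex.I)) = -1 := by
      change Complex.exp (θ * Complex.I) * -Complex.exp (-(θ * Complex.I)) = -1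
      rw [mul_neg, ← Complex.exp_add, add_neg_cancel, Complex.exp_zero]
    refine (spectrum.smul_mem_smul_iff (r := Units.mk0 (z : ℂ) hzne)).1 ?_
    rw [hm]
    exact h
  · rw [hsmul, show (z : ℂ) • (U : G →L[ℂ] G) - U = ((z : ℂ) - 1) • (U : G →L[ℂ] G) by
      rw [sub_smul, one_smul], norm_smul]
    have : ‖(U : G →L[ℂ] G)‖ ≤ 1 :=
      ContinuousLinearMap.opNorm_le_bound _ zero_le_one fun x => by
        rw [Unitary.norm_map, one_mul]
    nlinarith [norm_nonneg ((z : ℂ) - 1), norm_nonneg (U : G →L[ℂ] G)]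

theorem LinearIsometry.exists_unitary_comp [FiniteDimensional ℂ G] [CompleteSpace G]
    (V W : F →ₗᵢ[ℂ] G) : ∃ U : unitary (G →L[ℂ] G), ∀ x, (U : G →L[ℂ] G) (V x) = W x := by
  let L := (W.comp V.equivRange.symm.toLinearIsometry).extend
  refine ⟨Unitary.linearIsometryEquiv.symm (L.toLinearIsometryEquiv rfl), fun x => ?_⟩
  have := (W.comp V.equivRange.symm.toLinearIsometry).extend_apply (V.equivRange x)
  simpa [L] using this

theorem norm_sqrt_apply_sq [CompleteSpace F] {C : F →L[ℂ] F} (hC : 0 ≤ C) (x : F) :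
    ‖CFC.sqrt C x‖ ^ 2 = (inner ℂ (C x) x).re := by
  have h : IsSelfAdjoint (CFC.sqrt C) := (CFC.sqrt_nonneg C).isSelfAdjoint
  have h2 : CFC.sqrt C * CFC.sqrt C = C := CFC.sqrt_mul_sqrt_self C
  conv_rhs => rw [← h2]
  rw [mul_apply_eq_comp, h.isSymmetric.apply_clm, inner_self_eq_norm_sq_to_K]
  norm_cast

/-- Polar decomposition of an injective operator. -/
theorem exists_isometry_comp_eq [FiniteDimensional ℂ F] (S : F →L[ℂ] F) (w : F →L[ℂ] G)
    (hS : Function.Injective S) (h : ∀ x, ‖S x‖ = ‖w x‖) :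
    ∃ V : F →ₗᵢ[ℂ] G, ∀ x, V (S x) = w x := by
  let e : F ≃ₗ[ℂ] F := LinearEquiv.ofInjectiveEndo (S : F →ₗ[ℂ] F) hS
  have he : ∀ x, e x = S x := fun x => rfl
  refine ⟨⟨(w : F →ₗ[ℂ] G) ∘ₗ e.symm.toLinearMap, fun x => ?_⟩, fun x => ?_⟩
  · obtain ⟨y, rfl⟩ := e.surjective x
    change ‖w (e.symm (e y))‖ = ‖e y‖
    rw [e.symm_apply_apply, he, h]
  · rw [← he]; simp

/-- The path is the product of a path of isometries and the square root of a segment of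
positive operators. -/
theorem exists_path_of_injective [FiniteDimensional ℂ F] [FiniteDimensional ℂ G]
    (w₀ w₁ : F →L[ℂ] G) (h₀ : Function.Injective w₀) (h₁ : Function.Injective w₁) :
    ∃ γ : Path w₀ w₁, ∀ (t : unitInterval) (x : F),
      ‖γ t x‖ ^ 2 = (1 - t) * ‖w₀ x‖ ^ 2 + t * ‖w₁ x‖ ^ 2 := by
  have := FiniteDimensional.complete ℂ F
  have := FiniteDimensional.complete ℂ G
  let C (w : F →L[ℂ] G) : F →L[ℂ] F := w.adjoint ∘L w
  have hC (w : F →L[ℂ] G) : 0 ≤ C w :=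
    (ContinuousLinearMap.nonneg_iff_isPositive _).2 w.isPositive_adjoint_comp_self
  have hCx (w : F →L[ℂ] G) (x : F) : (inner ℂ (C w x) x).re = ‖w x‖ ^ 2 := by
    simp only [C, ContinuousLinearMap.comp_apply, ContinuousLinearMap.adjoint_inner_left]
    rw [inner_self_eq_norm_sq_to_K]
    norm_cast
  have hS (w : F →L[ℂ] G) (x : F) : ‖CFC.sqrt (C w) x‖ = ‖w x‖ := by
    rw [← sq_eq_sq₀ (norm_nonneg _) (norm_nonneg _), norm_sqrt_apply_sq (hC w), hCx]
  have hinj (w : F →L[ℂ] G) (hw : Function.Injective w) :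
      Function.Injective (CFC.sqrt (C w) : F →L[ℂ] F) := by
    rw [injective_iff_map_eq_zero] at hw ⊢
    intro x hx
    exact hw x (by rw [← norm_eq_zero, ← hS, hx, norm_zero])
  obtain ⟨V₀, hV₀⟩ := exists_isometry_comp_eq _ w₀ (hinj w₀ h₀) (hS w₀)
  obtain ⟨V₁, hV₁⟩ := exists_isometry_comp_eq _ w₁ (hinj w₁ h₁) (hS w₁)
  obtain ⟨U, hU⟩ := V₀.exists_unitary_comp V₁
  obtain ⟨δ⟩ := joined_one_unitary U
  -- With `w₀ = V₀ √C₀`, `w₁ = V₁ √C₁` and `U V₀ = V₁`, the path is `δ(t) V₀ √D(t)`. The isometric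
  -- factor drops out of norms, so the squared norm is the form of `D(t)`, which is affine in `t`.
  let D (t : unitInterval) : F →L[ℂ] F := ((1 - t : ℝ) : ℂ) • C w₀ + ((t : ℝ) : ℂ) • C w₁
  have hD (t : unitInterval) : 0 ≤ D t := by
    rw [ContinuousLinearMap.nonneg_iff_isPositive]
    have h0 := (ContinuousLinearMap.nonneg_iff_isPositive _).1 (hC w₀)
    have h1 := (ContinuousLinearMap.nonneg_iff_isPositive _).1 (hC w₁)
    exact (h0.smul_of_nonneg (by exact_mod_cast sub_nonneg.2 t.2.2)).add
      (h1.smul_of_nonneg (by exact_mod_cast t.2.1))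
  have hDc : Continuous D := by fun_prop
  have hsq : Continuous fun t => CFC.sqrt (D t) :=
    CFC.continuousOn_sqrt.comp_continuous hDc hD
  refine ⟨⟨⟨fun t => ((δ t : G →L[ℂ] G) ∘L V₀.toContinuousLinearMap) ∘L CFC.sqrt (D t), ?_⟩,
    ?_, ?_⟩, fun t x => ?_⟩
  · have : Continuous fun t => (δ t : G →L[ℂ] G) := continuous_subtype_val.comp δ.continuous
    fun_prop
  · ext x
    simp [D, hV₀]
  · ext x
    simp [D, hU, hV₁]
  · change ‖(δ t : G →L[ℂ] G) (V₀ (CFC.sqrt (D t) x))‖ ^ 2 = _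
    rw [Unitary.norm_map, V₀.norm_map, norm_sqrt_apply_sq (hD t)]
    simp only [D, add_apply, smul_apply, inner_add_left,
      inner_smul_left, Complex.conj_ofReal, Complex.add_re, Complex.re_ofReal_mul, hCx]

/-- Definiteness makes `√B` invertible, and the `B`-form is the squared norm after applying `√B`. So
the previous path is taken between `√B w₀` and `√B w₁`, then multiplied by the inverse of `√B`. -/
theorem exists_path_of_injective_of_posDef [FiniteDimensional ℂ F] [FiniteDimensional ℂ G]
    (B : G →L[ℂ] G) (hB : 0 ≤ B) (hB' : ∀ x, (inner ℂ (B x) x).re = 0 → x = 0)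
    (w₀ w₁ : F →L[ℂ] G) (h₀ : Function.Injective w₀) (h₁ : Function.Injective w₁) :
    ∃ γ : Path w₀ w₁, ∀ (t : unitInterval) (x : F), (inner ℂ (B (γ t x)) (γ t x)).re =
      (1 - t) * (inner ℂ (B (w₀ x)) (w₀ x)).re + t * (inner ℂ (B (w₁ x)) (w₁ x)).re := by
  have := FiniteDimensional.complete ℂ G
  have hS : Function.Injective (CFC.sqrt B : G →L[ℂ] G) := by
    rw [injective_iff_map_eq_zero]
    intro x hx
    exact hB' x (by rw [← norm_sqrt_apply_sq hB, hx]; simp)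
  let e : G ≃L[ℂ] G :=
    (LinearEquiv.ofInjectiveEndo ((CFC.sqrt B : G →L[ℂ] G) : G →ₗ[ℂ] G) hS).toContinuousLinearEquiv
  have he : ∀ x, e x = CFC.sqrt B x := fun x => rfl
  obtain ⟨γ, hγ⟩ := exists_path_of_injective ((e : G →L[ℂ] G) ∘L w₀) ((e : G →L[ℂ] G) ∘L w₁)
    (e.injective.comp h₀) (e.injective.comp h₁)
  refine ⟨⟨⟨fun t => (e.symm : G →L[ℂ] G) ∘L γ t, by fun_prop⟩, ?_, ?_⟩, fun t x => ?_⟩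
  · ext x; simp
  · ext x; simp
  · have := hγ t x
    simp only [ContinuousLinearMap.comp_apply, ContinuousLinearEquiv.coe_coe, he,
      norm_sqrt_apply_sq hB] at this
    rw [← this, ← norm_sqrt_apply_sq hB, ← he]
    simp

/-- The solution is `w = B^(-1/2) J A^(1/2)` for any unitary `J : F → G`. -/
theorem exists_form_eq [FiniteDimensional ℂ F] [FiniteDimensional ℂ G]
    (hFG : Module.finrank ℂ F = Module.finrank ℂ G) (A : F →L[ℂ] F) (hA : 0 ≤ A)
    (B : G →L[ℂ] G) (hB : 0 ≤ B) (hB' : ∀ x, (inner ℂ (B x) x).re = 0 → x = 0) :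
    ∃ w : F →L[ℂ] G, ∀ x, (inner ℂ (B (w x)) (w x)).re = (inner ℂ (A x) x).re := by
  have := FiniteDimensional.complete ℂ F
  have := FiniteDimensional.complete ℂ G
  have hS : Function.Injective (CFC.sqrt B : G →L[ℂ] G) := by
    rw [injective_iff_map_eq_zero]
    intro x hx
    exact hB' x (by rw [← norm_sqrt_apply_sq hB, hx]; simp)
  let e : G ≃L[ℂ] G :=
    (LinearEquiv.ofInjectiveEndo ((CFC.sqrt B : G →L[ℂ] G) : G →ₗ[ℂ] G) hS).toContinuousLinearEquiv
  have he : ∀ x, e x = CFC.sqrt B x := fun x => rfl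
  let J : F ≃ₗᵢ[ℂ] G := (stdOrthonormalBasis ℂ F).equiv (stdOrthonormalBasis ℂ G) (finCongr hFG)
  refine ⟨(e.symm : G →L[ℂ] G) ∘L (J.toContinuousLinearEquiv : F →L[ℂ] G) ∘L CFC.sqrt A,
    fun x => ?_⟩
  rw [← norm_sqrt_apply_sq hB, ← norm_sqrt_apply_sq hA, ← he]
  simp

end FiniteDimensional

/-! ### Spectral subspaces of positive compact operators -/

section Spectral

variable {H : Type*} [NormedAddCommGroup H] [InnerProductSpace ℂ H]

/-- The spectral decomposition of a finite sum of eigenvectors. -/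
theorem LinearMap.IsSymmetric.exists_sum_of_mem_iSup_eigenspace {T : H →ₗ[ℂ] H}
    (hT : T.IsSymmetric) {ι : Type*} {m : ι → ℝ} (hm : Function.Injective m) {x : H}
    (hx : x ∈ ⨆ i, Module.End.eigenspace T (m i : ℂ)) :
    ∃ (s : Finset ι) (v : ι → H), ‖x‖ ^ 2 = ∑ i ∈ s, ‖v i‖ ^ 2 ∧
      (inner ℂ (T x) x).re = ∑ i ∈ s, m i * ‖v i‖ ^ 2 := by
  classical
  obtain ⟨f, hf, rfl⟩ := (Submodule.mem_iSup_iff_exists_finsupp _ _).1 hx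
  have hT' (i : ι) : T (f i) = (m i : ℂ) • f i := Module.End.mem_eigenspace_iff.1 (hf i)
  have horth (i j : ι) (hij : i ≠ j) : inner ℂ (f i) (f j) = 0 :=
    hT.orthogonalFamily_eigenspaces.comp (γ := ι) (f := fun i => (m i : ℂ))
      (Complex.ofReal_injective.comp hm) hij ⟨f i, hf i⟩ ⟨f j, hf j⟩
  have key (c : ι → ℂ) : inner ℂ (∑ i ∈ f.support, c i • f i) (∑ i ∈ f.support, f i) =
      ∑ i ∈ f.support, star (c i) * (‖f i‖ : ℂ) ^ 2 := by
    rw [sum_inner]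
    refine Finset.sum_congr rfl fun i hi => ?_
    rw [inner_sum, Finset.sum_eq_single i]
    · rw [inner_smul_left, inner_self_eq_norm_sq_to_K]
      rfl
    · intro j _ hj
      rw [inner_smul_left, horth i j hj.symm, mul_zero]
    · exact fun h => absurd hi h
  refine ⟨f.support, f, ?_, ?_⟩
  · have := key 1
    simp only [Pi.one_apply, one_smul, star_one, one_mul] at this
    rw [inner_self_eq_norm_sq_to_K] at this
    refine Complex.ofReal_injective ?_
    push_cast
    exact this
  · have := key fun i => (m i : ℂ)
    simp only [Finsupp.sum, map_sum, hT', this, Complex.star_def, Complex.conj_ofReal]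
    norm_cast

/-- The unit ball is contained in the preimage of a totally bounded set under a uniform embedding.
-/
theorem finiteDimensional_of_isCompactOperator {E : Type*} [NormedAddCommGroup E] [NormedSpace ℂ E]
    {E' : Type*} [NormedAddCommGroup E'] [NormedSpace ℂ E']
    {T : E →L[ℂ] E'} (hT : IsCompactOperator T) {c : NNReal} (h : AntilipschitzWith c T) :
    FiniteDimensional ℂ E := by
  refine .of_totallyBounded_nhds_zero ℂ (Metric.closedBall_mem_nhds 0 one_pos) ?_
  refine (totallyBounded_preimage (h.isUniformInducing T.uniformContinuous)
    ((hT.isCompact_closure_image_closedBall 1).totallyBounded)).subset ?_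
  exact fun x hx => subset_closure ⟨x, hx, rfl⟩

/-- `K` is the sum of the eigenspaces with eigenvalue above `ε`, and `W` the sum of the others. `T`
is bounded below on `K`, so compactness makes `K` finite-dimensional. The strict bound on `K` later
yields injectivity of compressed witnesses. -/
theorem exists_spectral_subspace [CompleteSpace H] {T : H →L[ℂ] H} (hT : IsCompactOperator T)
    (hpos : 0 ≤ T) {ε : ℝ} (hε : 0 < ε) :
    ∃ K : Submodule ℂ H, FiniteDimensional ℂ K ∧ (∀ x ∈ K, T x ∈ K) ∧
      (∀ x ∈ K, x ≠ 0 → ε * ‖x‖ ^ 2 < (inner ℂ (T x) x).re) ∧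
      ∀ x ∈ Kᗮ, (inner ℂ (T x) x).re ≤ ε * ‖x‖ ^ 2 := by
  have hsym : (T : H →ₗ[ℂ] H).IsSymmetric :=
    ((ContinuousLinearMap.nonneg_iff_isPositive T).1 hpos).isSymmetric
  let K : Submodule ℂ H := ⨆ μ : Ioi ε, Module.End.eigenspace (T : H →ₗ[ℂ] H) ((μ : ℝ) : ℂ)
  let W : Submodule ℂ H := ⨆ μ : Iic ε, Module.End.eigenspace (T : H →ₗ[ℂ] H) ((μ : ℝ) : ℂ)
  have hK (x : H) (hx : x ∈ K) (hx0 : x ≠ 0) : ε * ‖x‖ ^ 2 < (inner ℂ (T x) x).re := by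
    obtain ⟨s, v, h1, h2⟩ := hsym.exists_sum_of_mem_iSup_eigenspace Subtype.val_injective hx
    change (inner ℂ (T x) x).re = _ at h2
    rw [h1, h2, Finset.mul_sum]
    have hne : ∃ i ∈ s, ‖v i‖ ^ 2 ≠ 0 := by
      apply Finset.exists_ne_zero_of_sum_ne_zero
      rw [← h1]
      positivity
    obtain ⟨i, hi, hi0⟩ := hne
    refine Finset.sum_lt_sum (fun i _ => ?_) ⟨i, hi, ?_⟩
    · exact mul_le_mul_of_nonneg_right (le_of_lt i.2) (by positivity)
    · exact mul_lt_mul_of_pos_right i.2 (by positivity)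
  have hW (x : H) (hx : x ∈ W) : (inner ℂ (T x) x).re ≤ ε * ‖x‖ ^ 2 := by
    obtain ⟨s, v, h1, h2⟩ := hsym.exists_sum_of_mem_iSup_eigenspace Subtype.val_injective hx
    change (inner ℂ (T x) x).re = _ at h2
    rw [h1, h2, Finset.mul_sum]
    exact Finset.sum_le_sum fun i _ => mul_le_mul_of_nonneg_right i.2 (by positivity)
  have hKW : K ⟂ W := by
    rw [Submodule.isOrtho_iSup_left]
    intro i
    rw [Submodule.isOrtho_iSup_right]
    intro j
    refine hsym.orthogonalFamily_eigenspaces.isOrtho fun h => ?_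
    have h' : (i : ℝ) = j := Complex.ofReal_injective h
    have h1 : ε < i := i.2
    have h2 : (j : ℝ) ≤ ε := j.2
    linarith
  have hfin : FiniteDimensional ℂ K := by
    refine finiteDimensional_of_isCompactOperator (T := T ∘L K.subtypeL)
      (hT.comp_clm K.subtypeL) (c := ε⁻¹.toNNReal) ?_
    refine ContinuousLinearMap.antilipschitz_of_bound _ fun x => ?_
    have hxT : ε * ‖(x : H)‖ ^ 2 ≤ ‖T x‖ * ‖(x : H)‖ := by
      rcases eq_or_ne (x : H) 0 with h0 | h0
      · simp [h0]
      · exact (hK x x.2 h0).le.trans ((Complex.re_le_norm _).trans (norm_inner_le_norm _ _))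
    rw [Real.coe_toNNReal _ (inv_nonneg.2 hε.le), inv_mul_eq_div, le_div_iff₀ hε]
    change ‖(x : H)‖ * ε ≤ ‖T x‖
    rcases eq_or_lt_of_le (norm_nonneg (x : H)) with h0 | h0
    · rw [← h0]; simp
    · exact le_of_mul_le_mul_right (by linarith) h0
  refine ⟨K, hfin, ?_, hK, ?_⟩
  · intro x hx
    refine Submodule.iSup_induction _ (motive := fun x => T x ∈ K) hx ?_ (by simp)
      fun y z hy hz => by rw [map_add]; exact K.add_mem hy hz
    intro i y hy
    have : T y = ((i : ℝ) : ℂ) • y := Module.End.mem_eigenspace_iff.1 hy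
    rw [this]
    exact K.smul_mem _ (Submodule.mem_iSup_of_mem i hy)
  · have htop : (K ⊔ W).topologicalClosure = ⊤ := by
      rw [Submodule.topologicalClosure_eq_top_iff, eq_bot_iff,
        ← ContinuousLinearMap.orthogonalComplement_iSup_eigenspaces_eq_bot hT hsym]
      refine Submodule.orthogonal_le (iSup_le fun μ => ?_)
      by_cases hμ : Module.End.HasEigenvalue (T : H →ₗ[ℂ] H) μ
      · have hre : ((μ.re : ℝ) : ℂ) = μ := Complex.conj_eq_iff_re.1 (hsym.conj_eigenvalue_eq_self hμ)
        rw [← hre]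
        rcases lt_or_ge ε μ.re with h | h
        · exact le_sup_of_le_left (le_iSup_of_le (⟨μ.re, h⟩ : Ioi ε) le_rfl)
        · exact le_sup_of_le_right (le_iSup_of_le (⟨μ.re, h⟩ : Iic ε) le_rfl)
      · rw [Module.End.hasEigenvalue_iff, not_not] at hμ
        rw [hμ]
        exact bot_le
    -- `P` sends the dense subspace `K ⊔ W` into `W`, where the bound is known. The bound for `P y`
    -- is a closed condition on `y`, hence holds everywhere, and `P` fixes `Kᗮ`.
    let P : H →L[ℂ] H := 1 - K.starProjection
    have hclosed : IsClosed {y : H | (inner ℂ (T (P y)) (P y)).re ≤ ε * ‖P y‖ ^ 2} := by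
      refine isClosed_le ?_ ?_ <;> fun_prop
    have hsub : ((K ⊔ W : Submodule ℂ H) : Set H) ⊆
        {y : H | (inner ℂ (T (P y)) (P y)).re ≤ ε * ‖P y‖ ^ 2} := by
      intro y hy
      obtain ⟨k, hk, w, hw, rfl⟩ := Submodule.mem_sup.1 hy
      have hPk : K.starProjection k = k := Submodule.starProjection_eq_self_iff.2 hk
      have hPw : K.starProjection w = 0 :=
        (Submodule.starProjection_apply_eq_zero_iff K).2 (hKW.symm hw)
      have : P (k + w) = w := by simp [P, hPk, hPw]
      rw [mem_ofPred_eq, this]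
      exact hW w hw
    intro x hx
    have hxP : P x = x := by
      simp [P, (Submodule.starProjection_apply_eq_zero_iff K).2 hx]
    have hmem : x ∈ (K ⊔ W).topologicalClosure := by rw [htop]; trivial
    have := closure_minimal hsub hclosed hmem
    rwa [mem_ofPred_eq, hxP] at this

theorem IsSelfAdjoint.norm_le_of_forall_abs_inner_le [CompleteSpace H] {X : H →L[ℂ] H}
    (hX : IsSelfAdjoint X)
    {ε : ℝ} (hε : 0 ≤ ε) (h : ∀ x, |(inner ℂ (X x) x).re| ≤ ε * ‖x‖ ^ 2) : ‖X‖ ≤ ε := by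
  rw [X.norm_eq_iSup_rayleighQuotient hX.isSymmetric]
  refine Real.iSup_le (fun x => ?_) hε
  rw [ContinuousLinearMap.rayleighQuotient, abs_div, abs_of_nonneg (sq_nonneg ‖x‖)]
  exact div_le_of_le_mul₀ (by positivity) hε (h x)

end Spectral

/-! ### Cuntz comparison of two positive compact operators -/

section CuntzPointwise

variable {H : Type*} [NormedAddCommGroup H] [InnerProductSpace ℂ H]

/-- The quadratic form `re ⟪T x, x⟫` of an operator. -/
noncomputable def quadForm (T : H →L[ℂ] H) (x : H) : ℝ := (inner ℂ (T x) x).re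

theorem quadForm_nonneg {T : H →L[ℂ] H} (hT : 0 ≤ T) (x : H) : 0 ≤ quadForm T x :=
  ((ContinuousLinearMap.nonneg_iff_isPositive T).1 hT).re_inner_nonneg_left x

theorem apply_eq_zero_of_quadForm_eq_zero [CompleteSpace H] {T : H →L[ℂ] H} (hT : 0 ≤ T) {x : H}
    (hx : quadForm T x = 0) : T x = 0 := by
  rw [quadForm, ← norm_sqrt_apply_sq hT, sq_eq_zero_iff, norm_eq_zero] at hx
  rw [← CFC.sqrt_mul_sqrt_self T, mul_apply_eq_comp, hx, map_zero]

/-- For `w = star r`, this set corresponds to the inequality `‖r * b * star r - a‖ ≤ ε`. -/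
def cuntzWitness (ε : ℝ) (a b : H →L[ℂ] H) : Set (H →L[ℂ] H) :=
  {w | IsCompactOperator w ∧ ∀ x, |quadForm b (w x) - quadForm a x| ≤ ε * ‖x‖ ^ 2}

/-- The operator equal to the identity on `K` and to multiplication by `s` on `Kᗮ`. -/
noncomputable def Submodule.pinch (K : Submodule ℂ H) [K.HasOrthogonalProjection] (s : ℝ) :
    H →L[ℂ] H :=
  K.starProjection + (s : ℂ) • (1 - K.starProjection)

theorem Submodule.pinch_apply (K : Submodule ℂ H) [K.HasOrthogonalProjection] (s : ℝ) (x : H) :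
    K.pinch s x = K.starProjection x + (s : ℂ) • (x - K.starProjection x) := by
  simp [Submodule.pinch]

theorem norm_sq_starProjection_add_smul (K : Submodule ℂ H) [K.HasOrthogonalProjection] (s : ℝ)
    (x : H) : ‖K.pinch s x‖ ^ 2 =
      ‖K.starProjection x‖ ^ 2 + s ^ 2 * ‖x - K.starProjection x‖ ^ 2 := by
  rw [K.pinch_apply]
  have h := norm_add_sq_eq_norm_sq_add_norm_sq_of_inner_eq_zero (𝕜 := ℂ) (K.starProjection x)
    ((s : ℂ) • (x - K.starProjection x)) (by
      rw [inner_smul_right, Submodule.inner_right_of_mem_orthogonal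
        (K.starProjection_apply_mem x) (K.sub_starProjection_mem_orthogonal x), mul_zero])
  rw [sq, h, norm_smul, Complex.norm_real, Real.norm_eq_abs, ← sq_abs s]
  ring

theorem quadForm_pinch {T : H →L[ℂ] H} (hT : 0 ≤ T) (K : Submodule ℂ H)
    [K.HasOrthogonalProjection] (hK : ∀ x ∈ K, T x ∈ K) (s : ℝ) (x : H) :
    quadForm T (K.pinch s x) =
      quadForm T (K.starProjection x) + s ^ 2 * quadForm T (x - K.starProjection x) := by
  have hsym : (T : H →ₗ[ℂ] H).IsSymmetric :=
    ((ContinuousLinearMap.nonneg_iff_isPositive T).1 hT).isSymmetric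
  have hu := K.starProjection_apply_mem x
  have hz := K.sub_starProjection_mem_orthogonal x
  have h1 : inner ℂ (T (K.starProjection x)) (x - K.starProjection x) = 0 :=
    Submodule.inner_right_of_mem_orthogonal (hK _ hu) hz
  have h2 : inner ℂ (T (x - K.starProjection x)) (K.starProjection x) = 0 := by
    rw [show inner ℂ (T (x - K.starProjection x)) (K.starProjection x) =
      inner ℂ (x - K.starProjection x) (T (K.starProjection x)) from hsym _ _]
    exact Submodule.inner_left_of_mem_orthogonal (hK _ hu) hz
  rw [K.pinch_apply]
  simp only [quadForm, map_add, map_smul, inner_add_left, inner_add_right, inner_smul_left,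
    inner_smul_right, h1, h2, Complex.conj_ofReal, mul_zero, add_zero, zero_add, Complex.add_re,
    Complex.re_ofReal_mul]
  ring

theorem pinch_one (K : Submodule ℂ H) [K.HasOrthogonalProjection] : K.pinch 1 = 1 := by
  simp [Submodule.pinch]

theorem pinch_zero (K : Submodule ℂ H) [K.HasOrthogonalProjection] :
    K.pinch 0 = K.starProjection := by
  simp [Submodule.pinch]

/-- Both forms split along the invariant subspaces. Pinching by `G` lowers the `b`-form by at most
`δ‖w‖²‖y‖²`, where `y = F.pinch s x`. Pinching by `F` lowers the `a`-form by at most `ε(‖x‖² -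
‖y‖²)`, since `a ≤ ε` on `Fᗮ`. The hypothesis `ε' + δ‖w‖² ≤ ε` absorbs both losses. -/
theorem pinch_mem_cuntzWitness {a b : H →L[ℂ] H} (ha : 0 ≤ a) (hb : 0 ≤ b) {ε δ ε' : ℝ}
    (hδ : 0 ≤ δ)
    (hε : 0 ≤ ε') (F G : Submodule ℂ H) [F.HasOrthogonalProjection] [G.HasOrthogonalProjection]
    (hF : ∀ x ∈ F, a x ∈ F) (hG : ∀ x ∈ G, b x ∈ G)
    (hF' : ∀ x ∈ Fᗮ, quadForm a x ≤ ε * ‖x‖ ^ 2) (hG' : ∀ x ∈ Gᗮ, quadForm b x ≤ δ * ‖x‖ ^ 2)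
    {w : H →L[ℂ] H} (hw : w ∈ cuntzWitness ε' a b) (hwδ : ε' + δ * ‖w‖ ^ 2 ≤ ε)
    {s : ℝ} (hs : s ∈ Icc (0 : ℝ) 1) : G.pinch s ∘L w ∘L F.pinch s ∈ cuntzWitness ε a b := by
  refine ⟨(hw.1.comp_clm (F.pinch s)).clm_comp (G.pinch s), fun x => ?_⟩
  have hs2 : s ^ 2 ≤ 1 := pow_le_one₀ hs.1 hs.2
  have hs0 : 0 ≤ s ^ 2 := sq_nonneg s
  set y := F.pinch s x with hy
  have hwy := hw.2 y
  have hnwy : ‖w y‖ ^ 2 ≤ ‖w‖ ^ 2 * ‖y‖ ^ 2 := by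
    rw [← mul_pow]
    exact pow_le_pow_left₀ (norm_nonneg _) (w.le_opNorm y) 2
  have hb1 := quadForm_pinch hb G hG s (w y)
  have hb2 := quadForm_pinch hb G hG 1 (w y)
  have hn1 := norm_sq_starProjection_add_smul G 1 (w y)
  have hb3 := hG' _ (G.sub_starProjection_mem_orthogonal (w y))
  have hb4 := quadForm_nonneg hb (w y - G.starProjection (w y))
  have ha1 := quadForm_pinch ha F hF s x
  have ha2 := quadForm_pinch ha F hF 1 x
  have hn2 := norm_sq_starProjection_add_smul F 1 x
  have hn3 := norm_sq_starProjection_add_smul F s x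
  have ha3 := hF' _ (F.sub_starProjection_mem_orthogonal x)
  have ha4 := quadForm_nonneg ha (x - F.starProjection x)
  rw [pinch_one] at hb2 hn1 ha2 hn2
  rw [← hy] at ha1 hn3
  change quadForm b (w y) = _ at hb2
  change quadForm a x = _ at ha2
  change ‖w y‖ ^ 2 = _ at hn1
  change ‖x‖ ^ 2 = _ at hn2
  change |quadForm b (G.pinch s (w y)) - quadForm a x| ≤ _
  rw [abs_le] at hwy ⊢
  have hε0 : ε' ≤ ε := by nlinarith [mul_nonneg hδ (sq_nonneg ‖w‖)]
  have hlow : quadForm b (w y) - δ * ‖w‖ ^ 2 * ‖y‖ ^ 2 ≤ quadForm b (G.pinch s (w y)) := by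
    have h1 : δ * ‖w y - G.starProjection (w y)‖ ^ 2 ≤ δ * ‖w y‖ ^ 2 := by
      apply mul_le_mul_of_nonneg_left _ hδ
      nlinarith [sq_nonneg ‖G.starProjection (w y)‖]
    have h2 : δ * ‖w y‖ ^ 2 ≤ δ * (‖w‖ ^ 2 * ‖y‖ ^ 2) := mul_le_mul_of_nonneg_left hnwy hδ
    have h3 := mul_nonneg hs0 hb4
    rw [hb1, hb2]
    linarith
  have hup : quadForm b (G.pinch s (w y)) ≤ quadForm b (w y) := by
    have h3 := mul_le_mul_of_nonneg_right hs2 hb4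
    rw [hb1, hb2]
    linarith
  have hy2 : ‖y‖ ^ 2 ≤ ‖x‖ ^ 2 := by
    have h3 := mul_le_mul_of_nonneg_right hs2 (sq_nonneg ‖x - F.starProjection x‖)
    rw [hn2, hn3]
    linarith
  constructor
  · have h1 : (ε' + δ * ‖w‖ ^ 2) * ‖y‖ ^ 2 ≤ ε * ‖y‖ ^ 2 :=
      mul_le_mul_of_nonneg_right hwδ (sq_nonneg _)
    have h2 : (1 - s ^ 2) * quadForm a (x - F.starProjection x) ≤
        (1 - s ^ 2) * (ε * ‖x - F.starProjection x‖ ^ 2) :=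
      mul_le_mul_of_nonneg_left ha3 (by linarith)
    have h3 : quadForm a y - ε * ‖y‖ ^ 2 ≥ quadForm a x - ε * ‖x‖ ^ 2 := by
      rw [ha1, ha2, hn2, hn3]
      linarith
    linarith [hwy.1]
  · have h1 : ε' * ‖y‖ ^ 2 ≤ ε * ‖x‖ ^ 2 :=
      mul_le_mul hε0 hy2 (sq_nonneg _) (hε.trans hε0)
    have h2 : quadForm a y ≤ quadForm a x := by
      have h3 := mul_le_mul_of_nonneg_right hs2 ha4
      rw [ha1, ha2]
      linarith
    linarith [hwy.2]

theorem joinedIn_pinch {a b : H →L[ℂ] H} (ha : 0 ≤ a) (hb : 0 ≤ b) {ε δ ε' : ℝ} (hδ : 0 ≤ δ)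
    (hε : 0 ≤ ε') (F G : Submodule ℂ H) [F.HasOrthogonalProjection] [G.HasOrthogonalProjection]
    (hF : ∀ x ∈ F, a x ∈ F) (hG : ∀ x ∈ G, b x ∈ G)
    (hF' : ∀ x ∈ Fᗮ, quadForm a x ≤ ε * ‖x‖ ^ 2) (hG' : ∀ x ∈ Gᗮ, quadForm b x ≤ δ * ‖x‖ ^ 2)
    {w : H →L[ℂ] H} (hw : w ∈ cuntzWitness ε' a b) (hwδ : ε' + δ * ‖w‖ ^ 2 ≤ ε) :
    JoinedIn (cuntzWitness ε a b) w (G.starProjection ∘L w ∘L F.starProjection) := by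
  refine ⟨⟨⟨fun t => G.pinch (unitInterval.symm t) ∘L w ∘L F.pinch (unitInterval.symm t), ?_⟩,
    ?_, ?_⟩, fun t => ?_⟩
  · unfold Submodule.pinch
    fun_prop
  · simp only [unitInterval.symm_zero, Icc.coe_one, pinch_one]
    rfl
  · simp only [unitInterval.symm_one, Icc.coe_zero, pinch_zero]
  · exact pinch_mem_cuntzWitness ha hb hδ hε F G hF hG hF' hG' hw hwδ (unitInterval.symm t).2

/-- The compression of an operator to a subspace. -/
noncomputable def compression (K : Submodule ℂ H) [K.HasOrthogonalProjection] (T : H →L[ℂ] H) :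
    K →L[ℂ] K :=
  K.orthogonalProjectionOnto ∘L T ∘L K.subtypeL

theorem compression_nonneg (K : Submodule ℂ H) [CompleteSpace H] [CompleteSpace K]
    {T : H →L[ℂ] H} (hT : 0 ≤ T) : 0 ≤ compression K T := by
  rw [ContinuousLinearMap.nonneg_iff_isPositive] at hT ⊢
  exact hT.orthogonalProjectionOnto_comp K

theorem quadForm_compression (K : Submodule ℂ H) [K.HasOrthogonalProjection] (T : H →L[ℂ] H)
    (x : K) : quadForm (compression K T) x = quadForm T x := by
  simp only [quadForm, compression, ContinuousLinearMap.comp_apply]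
  rw [Submodule.inner_orthogonalProjectionOnto_eq_of_mem_right]
  rfl

/-- The operator on `H` which is `u` on `F` and vanishes on `Fᗮ`. -/
noncomputable def extendByZero (F G : Submodule ℂ H) [F.HasOrthogonalProjection] (u : F →L[ℂ] G) :
    H →L[ℂ] H :=
  G.subtypeL ∘L u ∘L F.orthogonalProjectionOnto

theorem isCompactOperator_extendByZero (F G : Submodule ℂ H) [F.HasOrthogonalProjection]
    [FiniteDimensional ℂ G] (u : F →L[ℂ] G) : IsCompactOperator (extendByZero F G u) := by
  have h : IsCompactOperator (id : G → G) :=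
    (isCompactOperator_id_iff_finiteDimensional (𝕜 := ℂ)).2 inferInstance
  exact (h.comp_clm (u ∘L F.orthogonalProjectionOnto)).clm_comp G.subtypeL

/-- Both witnesses are pinched to maps `F → G`, and these are joined by injective maps with affine
`b`-form. The gap between `ε'` and `ε` pays for the truncation of `b`. -/
theorem joinedIn_cuntzWitness [CompleteSpace H] {a b : H →L[ℂ] H} (ha : 0 ≤ a) (hb : 0 ≤ b)
    (hac : IsCompactOperator a) (hbc : IsCompactOperator b) {ε ε' : ℝ} (hε : 0 ≤ ε') (hεε : ε' < ε)
    {w₀ w₁ : H →L[ℂ] H} (hw₀ : w₀ ∈ cuntzWitness ε' a b) (hw₁ : w₁ ∈ cuntzWitness ε' a b) :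
    JoinedIn (cuntzWitness ε a b) w₀ w₁ := by
  obtain ⟨F, hFfin, hF, hFpos, hF'⟩ := exists_spectral_subspace hac ha (hε.trans_lt hεε)
  set M := max (‖w₀‖ ^ 2) (‖w₁‖ ^ 2) + 1 with hM
  have hM0 : ‖w₀‖ ^ 2 ≤ M := by linarith [le_max_left (‖w₀‖ ^ 2) (‖w₁‖ ^ 2)]
  have hM1 : ‖w₁‖ ^ 2 ≤ M := by linarith [le_max_right (‖w₀‖ ^ 2) (‖w₁‖ ^ 2)]
  have hMpos : 0 < M := by
    have := le_max_left (‖w₀‖ ^ 2) (‖w₁‖ ^ 2)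
    nlinarith [sq_nonneg ‖w₀‖]
  -- The witness is `δ = (ε - ε') / M`, so one cutoff for `b` serves both `w₀` and `w₁`.
  obtain ⟨δ, hδ, hδM⟩ : ∃ δ : ℝ, 0 < δ ∧ ε' + δ * M ≤ ε :=
    ⟨(ε - ε') / M, div_pos (by linarith) hMpos, by rw [div_mul_cancel₀ _ hMpos.ne']; linarith⟩
  obtain ⟨G, hGfin, hG, hGpos, hG'⟩ := exists_spectral_subspace hbc hb hδ
  have hj₀ := joinedIn_pinch ha hb hδ.le hε F G hF hG hF' hG' hw₀
    ((add_le_add_right (mul_le_mul_of_nonneg_left hM0 hδ.le) _).trans hδM)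
  have hj₁ := joinedIn_pinch ha hb hδ.le hε F G hF hG hF' hG' hw₁
    ((add_le_add_right (mul_le_mul_of_nonneg_left hM1 hδ.le) _).trans hδM)
  refine (hj₀.trans ?_).trans hj₁.symm
  let u (w : H →L[ℂ] H) : F →L[ℂ] G := G.orthogonalProjectionOnto ∘L w ∘L F.subtypeL
  have hu (w : H →L[ℂ] H) :
      G.starProjection ∘L w ∘L F.starProjection = extendByZero F G (u w) := rfl
  rw [hu, hu] at *
  have hquad (v : F →L[ℂ] G) (x : H) : quadForm b (extendByZero F G v x) =
      quadForm (compression G b) (v (F.orthogonalProjectionOnto x)) :=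
    (quadForm_compression G b _).symm
  -- If `v x = 0`, the witness inequality bounds the `a`-form at `x` by `ε‖x‖²`, contradicting the
  -- strict lower bound on `F`.
  have hinj (v : F →L[ℂ] G) (hv : extendByZero F G v ∈ cuntzWitness ε a b) :
      Function.Injective v := by
    rw [injective_iff_map_eq_zero]
    intro x hx
    by_contra hx0
    have h1 := hFpos x x.2 (by simpa using hx0)
    have h2 := hv.2 x
    have h3 : extendByZero F G v x = 0 := by simp [extendByZero, hx]
    rw [h3, abs_le] at h2
    simp only [quadForm, map_zero, inner_zero_left, Complex.zero_re] at h2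
    linarith [h2.1]
  obtain ⟨γ, hγ⟩ := exists_path_of_injective_of_posDef (compression G b) (compression_nonneg G hb)
    (fun x hx => by
      by_contra hx0
      have h1 := hGpos x x.2 (by simpa using hx0)
      have h2 : quadForm b x = 0 := by rw [← quadForm_compression]; exact hx
      unfold quadForm at h2
      rw [h2] at h1
      nlinarith [sq_nonneg ‖(x : H)‖])
    (u w₀) (u w₁) (hinj _ hj₀.target_mem) (hinj _ hj₁.target_mem)
  refine ⟨⟨⟨fun t => extendByZero F G (γ t), ?_⟩, ?_, ?_⟩, fun t => ?_⟩
  · unfold extendByZero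
    fun_prop
  · simp
  · simp
  · refine ⟨isCompactOperator_extendByZero F G _, fun x => ?_⟩
    have h0 := hj₀.target_mem.2 x
    have h1 := hj₁.target_mem.2 x
    have ht := hγ t (F.orthogonalProjectionOnto x)
    simp only [Path.coe_mk_mk]
    rw [hquad, abs_le] at h0 h1 ⊢
    change quadForm (compression G b) _ =
      (1 - t) * quadForm (compression G b) _ + t * quadForm (compression G b) _ at ht
    rw [ht]
    have ht0 := t.2.1
    have ht1 : 0 ≤ 1 - (t : ℝ) := sub_nonneg.2 t.2.2
    constructor
    · nlinarith [mul_le_mul_of_nonneg_left h0.1 ht1, mul_le_mul_of_nonneg_left h1.1 ht0]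
    · nlinarith [mul_le_mul_of_nonneg_left h0.2 ht1, mul_le_mul_of_nonneg_left h1.2 ht0]

theorem finrank_le_operatorRank {a : HilbertL2 →L[ℂ] HilbertL2} (F : Submodule ℂ HilbertL2)
    [FiniteDimensional ℂ F] (h : ∀ x ∈ F, a x = 0 → x = 0) :
    (Module.finrank ℂ F : ℕ∞) ≤ operatorRank a := by
  rw [natCast_le_operatorRank_iff]
  let f : F →ₗ[ℂ] HilbertL2 := a.toLinearMap ∘ₗ F.subtype
  have hf : LinearMap.ker f = ⊥ :=
    LinearMap.ker_eq_bot'.2 fun x hx => Subtype.ext (h x x.2 hx)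
  exact ⟨fun i => Module.finBasis ℂ F i, (Module.finBasis ℂ F).linearIndependent.map' f hf⟩

/-- The spectral subspace `F` of `a` above `ε` has dimension at most `rank b`, so `b` is injective
on some `G` of the same dimension. There the `b`-form is definite and can reproduce the `a`-form on
`F` exactly. The only error comes from `Fᗮ` and is at most `ε`. `G` need not be invariant under `b`.
-/
theorem cuntzWitness_nonempty {a b : HilbertL2 →L[ℂ] HilbertL2} (ha : 0 ≤ a) (hb : 0 ≤ b)
    (hac : IsCompactOperator a) (hab : operatorRank a ≤ operatorRank b) {ε : ℝ} (hε : 0 < ε) :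
    (cuntzWitness ε a b).Nonempty := by
  obtain ⟨F, hFfin, hF, hFpos, hF'⟩ := exists_spectral_subspace hac ha hε
  have hrank := finrank_le_operatorRank F fun x hx hx0 => by
    by_contra hx1
    have h1 := hFpos x hx hx1
    rw [hx0, inner_zero_left, Complex.zero_re] at h1
    nlinarith [sq_nonneg ‖x‖]
  obtain ⟨v, hv⟩ := (natCast_le_operatorRank_iff _ _).1 (hrank.trans hab)
  have hvi : LinearIndependent ℂ v := LinearIndependent.of_comp b.toLinearMap hv
  let G : Submodule ℂ HilbertL2 := Submodule.span ℂ (range v)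
  have hGfin : FiniteDimensional ℂ G := FiniteDimensional.span_of_finite ℂ (finite_range v)
  have hdim : Module.finrank ℂ F = Module.finrank ℂ G := by
    rw [finrank_span_eq_card hvi, Fintype.card_fin]
  obtain ⟨u, hu⟩ := exists_form_eq hdim (compression F a) (compression_nonneg F ha)
    (compression G b) (compression_nonneg G hb) (fun x hx => by
      have h2 : quadForm b x = 0 := by rw [← quadForm_compression]; exact hx
      have h3 := apply_eq_zero_of_quadForm_eq_zero hb h2
      obtain ⟨c, hc⟩ := (Submodule.mem_span_range_iff_exists_fun ℂ).1 x.2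
      rw [← hc, map_sum] at h3
      simp only [map_smul] at h3
      have h4 := Fintype.linearIndependent_iff.1 hv c h3
      ext1
      rw [← hc]
      simp [h4])
  refine ⟨extendByZero F G u, isCompactOperator_extendByZero F G u, fun x => ?_⟩
  have h1 : quadForm b (extendByZero F G u x) = quadForm a (F.starProjection x) := by
    have h2 := hu (F.orthogonalProjectionOnto x)
    change quadForm (compression G b) _ = quadForm (compression F a) _ at h2
    rw [quadForm_compression, quadForm_compression] at h2
    exact h2
  have ha2 := quadForm_pinch ha F hF 1 x
  have hn2 := norm_sq_starProjection_add_smul F 1 x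
  rw [pinch_one] at ha2 hn2
  change quadForm a x = _ at ha2
  change ‖x‖ ^ 2 = _ at hn2
  have ha3 := hF' _ (F.sub_starProjection_mem_orthogonal x)
  change quadForm a _ ≤ _ at ha3
  have ha4 := quadForm_nonneg ha (x - F.starProjection x)
  rw [h1, ha2, hn2, abs_le]
  have := mul_nonneg hε.le (sq_nonneg ‖F.starProjection x‖)
  constructor <;> nlinarith

/-- The form of `r b r* - a` at `x` is the `b`-form at `r* x` minus the `a`-form at `x`, and the
norm of a self-adjoint operator is the supremum of its form on unit vectors. -/
theorem norm_sub_le_iff_star_mem_cuntzWitness [CompleteSpace H] {a b r : H →L[ℂ] H} (ha : 0 ≤ a)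
    (hb : 0 ≤ b) (hr : IsCompactOperator (star r : H →L[ℂ] H)) {ε : ℝ} (hε : 0 ≤ ε) :
    ‖r * b * star r - a‖ ≤ ε ↔ star r ∈ cuntzWitness ε a b := by
  have hq (x : H) : (inner ℂ ((r * b * star r - a) x) x).re =
      quadForm b ((star r : H →L[ℂ] H) x) - quadForm a x := by
    simp only [quadForm, sub_apply, inner_sub_left, Complex.sub_re, mul_apply_eq_comp,
      ContinuousLinearMap.star_eq_adjoint, ContinuousLinearMap.adjoint_inner_right]
  constructor
  · refine fun h => ⟨hr, fun x => ?_⟩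
    rw [← hq]
    calc _ ≤ ‖(r * b * star r - a) x‖ * ‖x‖ :=
          (Complex.abs_re_le_norm _).trans (norm_inner_le_norm _ _)
      _ ≤ (‖r * b * star r - a‖ * ‖x‖) * ‖x‖ := by gcongr; exact ContinuousLinearMap.le_opNorm _ _
      _ ≤ ε * ‖x‖ ^ 2 := by rw [mul_assoc, ← sq]; gcongr
  · intro h
    have hsa : IsSelfAdjoint (r * b * star r - a) :=
      ((IsSelfAdjoint.of_nonneg hb).conjugate r).sub (IsSelfAdjoint.of_nonneg ha)
    exact hsa.norm_le_of_forall_abs_inner_le hε fun x => by rw [hq]; exact h.2 x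

end CuntzPointwise

/-! ### Continuous selection over the interval and the order embedding -/

section Embedding

/-- At time `t` the section leaves `f` and runs along a path in the fibre over `t` from `f t` to
`r`, then stays at `r`. By the tube lemma the whole path lies in the nearby fibres, so it suffices
to traverse it within time `δ / 2`. -/
theorem exists_continuous_section_extend {E : Type*} [TopologicalSpace E] {S : Set (ℝ × E)}
    (hS : IsOpen S)
    (hpc : ∀ t r r', (t, r) ∈ S → (t, r') ∈ S → JoinedIn {r | (t, r) ∈ S} r r')
    {a t t' : ℝ} (hat : a ≤ t) {f : ℝ → E} (hf : Continuous f) (hfS : ∀ s ∈ Icc a t, (s, f s) ∈ S)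
    {r : E} (htt : t ≤ t') (hr : ∀ s ∈ Icc t t', (s, r) ∈ S) :
    ∃ g : ℝ → E, Continuous g ∧ ∀ s ∈ Icc a t', (s, g s) ∈ S := by
  obtain ⟨γ, hγ⟩ := hpc t (f t) r (hfS t ⟨hat, le_rfl⟩) (hr t ⟨le_rfl, htt⟩)
  have htube : ∀ᶠ s in 𝓝 t, ∀ θ ∈ (univ : Set unitInterval), (s, γ θ) ∈ S := by
    refine isCompact_univ.eventually_forall_of_forall_eventually fun θ _ => ?_
    have hc : Continuous fun z : ℝ × unitInterval => (z.1, γ z.2) := by fun_prop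
    exact hc.continuousAt.eventually (hS.mem_nhds (hγ θ))
  obtain ⟨δ, hδ, hball⟩ := Metric.eventually_nhds_iff.1 htube
  refine ⟨fun s => if s ≤ t then f s else γ.extend ((s - t) / (δ / 2)), ?_, fun s hs => ?_⟩
  · refine Continuous.if_le hf (by fun_prop) continuous_id continuous_const fun s hs => ?_
    simp [hs]
  · change (s, if s ≤ t then f s else γ.extend ((s - t) / (δ / 2))) ∈ S
    split_ifs with hst
    · exact hfS s ⟨hs.1, hst⟩
    · push Not at hst
      rcases le_or_gt (s - t) (δ / 2) with h | h
      · refine hball ?_ (projIcc 0 1 zero_le_one ((s - t) / (δ / 2))) (mem_univ _)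
        rw [Real.dist_eq, abs_of_pos (by linarith)]
        linarith
      · rw [γ.extend_of_one_le ((one_le_div (by positivity)).2 h.le)]
        exact hr s ⟨hst.le, hs.2⟩

/-- An open family of nonempty path connected sets over an interval has a continuous section. -/
theorem exists_continuous_section {E : Type*} [TopologicalSpace E] {S : Set (ℝ × E)}
    (hS : IsOpen S) (hne : ∀ t, ∃ r, (t, r) ∈ S)
    (hpc : ∀ t r r', (t, r) ∈ S → (t, r') ∈ S → JoinedIn {r | (t, r) ∈ S} r r') :
    ∃ f : ℝ → E, Continuous f ∧ ∀ t ∈ Icc (0 : ℝ) 1, (t, f t) ∈ S := by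
  -- Openness makes each fibre point a constant local section. A subdivision of `[0,1]` gives one
  -- constant per subinterval, and these are joined inductively.
  obtain ⟨t, ht0, htm, ⟨n, hn⟩, htc⟩ := exists_monotone_Icc_subset_open_cover_unitInterval
    (c := fun r : E => {t : unitInterval | ((t : ℝ), r) ∈ S})
    (fun r => hS.preimage (by fun_prop)) (fun t _ => by simpa using hne t)
  have key (k : ℕ) : ∃ f : ℝ → E, Continuous f ∧ ∀ s ∈ Icc (0 : ℝ) (t k), (s, f s) ∈ S := by
    induction k with
    | zero =>
      obtain ⟨r, hr⟩ := hne 0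
      refine ⟨fun _ => r, continuous_const, fun s hs => ?_⟩
      rw [ht0] at hs
      rwa [le_antisymm hs.2 hs.1]
    | succ k ih =>
      obtain ⟨f, hf, hfS⟩ := ih
      obtain ⟨r, hr⟩ := htc k
      exact exists_continuous_section_extend hS hpc (t k).2.1 hf hfS (htm k.le_succ)
        fun s hs => hr (show (⟨s, (t k).2.1.trans hs.1, hs.2.trans (t (k + 1)).2.2⟩ :
          unitInterval) ∈ Icc (t k) (t (k + 1)) from hs)
  obtain ⟨f, hf, hfS⟩ := key n
  rw [hn n le_rfl] at hfS
  exact ⟨f, hf, hfS⟩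

/-- The pointwise content of Cuntz comparison in `C([0, 1], 𝒦)`. -/
theorem joinedIn_compactOperators {a b : compactOperators}
    (ha : 0 ≤ (a : HilbertL2 →L[ℂ] HilbertL2)) (hb : 0 ≤ (b : HilbertL2 →L[ℂ] HilbertL2)) {ε : ℝ}
    {r r' : compactOperators} (hr : ‖r * b * star r - a‖ < ε) (hr' : ‖r' * b * star r' - a‖ < ε) :
    JoinedIn {r : compactOperators | ‖r * b * star r - a‖ < ε} r r' := by
  -- Witness sets use `≤`. A level strictly below `ε` keeps the path in the open set.
  obtain ⟨ε', hε', hεε⟩ := exists_between (max_lt hr hr')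
  have h0 : 0 ≤ ‖r * b * star r - a‖ := norm_nonneg _
  have hm : 0 ≤ max ‖r * b * star r - a‖ ‖r' * b * star r' - a‖ := h0.trans (le_max_left _ _)
  have hw : (star r : HilbertL2 →L[ℂ] HilbertL2) ∈
      cuntzWitness (max ‖r * b * star r - a‖ ‖r' * b * star r' - a‖) (a : HilbertL2 →L[ℂ] HilbertL2)
        (b : HilbertL2 →L[ℂ] HilbertL2) :=
    (norm_sub_le_iff_star_mem_cuntzWitness ha hb (star r).2 hm).1 (le_max_left _ _)
  have hw' : (star r' : HilbertL2 →L[ℂ] HilbertL2) ∈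
      cuntzWitness (max ‖r * b * star r - a‖ ‖r' * b * star r' - a‖) (a : HilbertL2 →L[ℂ] HilbertL2)
        (b : HilbertL2 →L[ℂ] HilbertL2) :=
    (norm_sub_le_iff_star_mem_cuntzWitness ha hb (star r').2 hm).1 (le_max_right _ _)
  obtain ⟨γ, hγ⟩ := joinedIn_cuntzWitness ha hb a.2 b.2 hm hε' hw hw'
  refine ⟨⟨⟨fun t => ⟨star (γ t), isCompactOperator_star (hγ t).1⟩,
    (continuous_star.comp γ.continuous).subtype_mk _⟩, ?_, ?_⟩, fun t => ?_⟩
  · ext1; simp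
  · ext1; simp
  · have hc : IsCompactOperator (star (star (γ t)) : HilbertL2 →L[ℂ] HilbertL2) := by
      rw [star_star]; exact (hγ t).1
    refine lt_of_le_of_lt ((norm_sub_le_iff_star_mem_cuntzWitness (r := star (γ t)) ha hb hc
      (hm.trans hε'.le)).2 ?_) hεε
    rw [star_star]
    exact hγ t

theorem cuntzSubequivalent_of_rank_le {a b : StableContinuousFunctions unitInterval}
    (ha : ∀ t, 0 ≤ (a t : HilbertL2 →L[ℂ] HilbertL2))
    (hb : ∀ t, 0 ≤ (b t : HilbertL2 →L[ℂ] HilbertL2))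
    (hab : ∀ t, operatorRank (a t) ≤ operatorRank (b t)) : CuntzSubequivalent a b := by
  rw [cuntzSubequivalent_iff]
  intro ε hε
  let p : ℝ → unitInterval := projIcc 0 1 zero_le_one
  have hp : Continuous p := continuous_projIcc
  have hcont : Continuous fun z : ℝ × compactOperators =>
      ‖z.2 * b (p z.1) * star z.2 - a (p z.1)‖ := by fun_prop
  have hsec : ∃ f : ℝ → compactOperators, Continuous f ∧ ∀ t ∈ Icc (0 : ℝ) 1,
      (t, f t) ∈ {z : ℝ × compactOperators | ‖z.2 * b (p z.1) * star z.2 - a (p z.1)‖ < ε} := by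
    refine exists_continuous_section (isOpen_lt hcont continuous_const) ?_ ?_
    · intro t
      obtain ⟨w, hw⟩ := cuntzWitness_nonempty (ha (p t)) (hb (p t)) (a (p t)).2 (hab (p t))
        -- Halving turns the non-strict witness bound into the strict one.
        (half_pos hε)
      refine ⟨⟨star w, isCompactOperator_star hw.1⟩, ?_⟩
      have hc : IsCompactOperator (star (star w) : HilbertL2 →L[ℂ] HilbertL2) := by
        rw [star_star]; exact hw.1
      refine lt_of_le_of_lt ((norm_sub_le_iff_star_mem_cuntzWitness (r := star w) (ha (p t))
        (hb (p t)) hc (half_pos hε).le).2 ?_) (half_lt_self hε)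
      rwa [star_star]
    · exact fun t r r' hr hr' => joinedIn_compactOperators (ha (p t)) (hb (p t)) hr hr'
  obtain ⟨f, hf, hfS⟩ := hsec
  refine ⟨⟨fun t => f t, by fun_prop⟩, ?_⟩
  rw [ContinuousMap.norm_lt_iff _ hε]
  intro t
  have := hfS t t.2
  change ‖f t * b (p t) * star (f t) - a (p t)‖ < ε at this
  rwa [show p t = t from projIcc_val zero_le_one t] at this

theorem PositiveElement.apply_nonneg {X : Type*} [TopologicalSpace X] [CompactSpace X]
    (a : PositiveElement (StableContinuousFunctions X)) (t : X) :
    0 ≤ (a.val t : HilbertL2 →L[ℂ] HilbertL2) := by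
  obtain ⟨c, hc⟩ := a.exists_eq_star_mul_self
  rw [hc]
  exact star_mul_self_nonneg (c t : HilbertL2 →L[ℂ] HilbertL2)

/-- The map `Cu(C[0, 1]) → Lsc([0, 1], {0, 1, 2, …, ∞})` is an order embedding. -/
theorem rankFunction_le_iff {x y : CuC unitInterval} : rankFunction x ≤ rankFunction y ↔ x ≤ y := by
  induction x using Quotient.inductionOn with | _ a
  induction y using Quotient.inductionOn with | _ b
  exact ⟨fun h => cuntzSubequivalent_of_rank_le a.apply_nonneg b.apply_nonneg h,
    fun h => rankFunctionOf_mono h⟩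

end Embedding

/-! ### Diagonal elements and their ranks -/

section Diagonal

/-- The standard orthonormal sequence of `ℓ²(ℕ)`. -/
noncomputable def stdVector (k : ℕ) : HilbertL2 := lp.single 2 k (1 : ℂ)

theorem orthonormal_stdVector : Orthonormal ℂ stdVector := by
  rw [orthonormal_iff_ite]
  intro i j
  rw [stdVector, stdVector, lp.inner_single_left, lp.single_apply]
  rcases eq_or_ne i j with rfl | h
  · simp
  · simp [h]

/-- The projection onto the line spanned by the `k`-th standard vector. -/
noncomputable def stdProjection (k : ℕ) : compactOperators :=
  ⟨InnerProductSpace.rankOne ℂ (stdVector k) (stdVector k), by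
    have h : IsCompactOperator (id : ℂ → ℂ) :=
      (isCompactOperator_id_iff_finiteDimensional (𝕜 := ℂ)).2 inferInstance
    exact (h.comp_clm (innerSL ℂ (stdVector k))).clm_comp
      (ContinuousLinearMap.toSpanSingleton ℂ (stdVector k))⟩

theorem norm_stdProjection (k : ℕ) : ‖stdProjection k‖ = 1 := by
  change ‖InnerProductSpace.rankOne ℂ (stdVector k) (stdVector k)‖ = 1
  simp [orthonormal_stdVector.1 k]

theorem star_stdProjection (k : ℕ) : star (stdProjection k) = stdProjection k := by
  ext1
  change star (InnerProductSpace.rankOne ℂ (stdVector k) (stdVector k)) =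
    InnerProductSpace.rankOne ℂ (stdVector k) (stdVector k)
  simp [ContinuousLinearMap.star_eq_adjoint]

variable {X : Type*} [TopologicalSpace X]

/-- The `k`-th diagonal entry of `diagonalFunction`. -/
noncomputable def diagonalTerm (g : ℕ → C(X, unitInterval)) (k : ℕ) (t : X) : compactOperators :=
  (((1 / 2 : ℝ) ^ k * g k t : ℝ) : ℂ) • stdProjection k

theorem norm_diagonalTerm_le (g : ℕ → C(X, unitInterval)) (k : ℕ) (t : X) :
    ‖diagonalTerm g k t‖ ≤ (1 / 2) ^ k := by
  have h0 := (g k t).2.1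
  rw [diagonalTerm, norm_smul, norm_stdProjection, mul_one, Complex.norm_real,
    Real.norm_of_nonneg (by positivity)]
  exact mul_le_of_le_one_right (by positivity) (g k t).2.2

variable [CompactSpace X]

/-- The function `t ↦ diag (g 0 t, g 1 t / 2, g 2 t / 4, …)`. -/
noncomputable def diagonalFunction (g : ℕ → C(X, unitInterval)) : StableContinuousFunctions X :=
  ⟨fun t => ∑' k, diagonalTerm g k t, by
    refine continuous_tsum (fun k => ?_) summable_geometric_two (norm_diagonalTerm_le g)
    unfold diagonalTerm
    fun_prop⟩

theorem hasSum_diagonalFunction (g : ℕ → C(X, unitInterval)) (t : X) :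
    HasSum (fun k => (((1 / 2 : ℝ) ^ k * g k t : ℝ) : ℂ) •
      (stdProjection k : HilbertL2 →L[ℂ] HilbertL2))
      (diagonalFunction g t : HilbertL2 →L[ℂ] HilbertL2) := by
  have hs : Summable fun k => diagonalTerm g k t :=
    .of_norm_bounded summable_geometric_two fun k => norm_diagonalTerm_le g k t
  exact hs.hasSum.map (AddSubmonoidClass.subtype compactOperators) continuous_subtype_val

theorem hasSum_diagonalFunction_apply (g : ℕ → C(X, unitInterval)) (t : X) (x : HilbertL2) :
    HasSum (fun k => (((1 / 2 : ℝ) ^ k * g k t : ℝ) : ℂ) • inner ℂ (stdVector k) x • stdVector k)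
      ((diagonalFunction g t : HilbertL2 →L[ℂ] HilbertL2) x) :=
  (hasSum_diagonalFunction g t).mapL (ContinuousLinearMap.apply ℂ HilbertL2 x)

theorem star_diagonalFunction_apply (g : ℕ → C(X, unitInterval)) (t : X) :
    star (diagonalFunction g t : HilbertL2 →L[ℂ] HilbertL2) = diagonalFunction g t := by
  have h1 := hasSum_diagonalFunction g t
  have h2 := h1.star
  have h (k : ℕ) : star (stdProjection k : HilbertL2 →L[ℂ] HilbertL2) = stdProjection k :=
    congrArg Subtype.val (star_stdProjection k)
  simp only [star_smul, h, Complex.star_def, Complex.conj_ofReal] at h2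
  exact h2.unique h1

theorem diagonalFunction_apply_stdVector (g : ℕ → C(X, unitInterval)) (t : X) (j : ℕ) :
    (diagonalFunction g t : HilbertL2 →L[ℂ] HilbertL2) (stdVector j) =
      (((1 / 2 : ℝ) ^ j * g j t : ℝ) : ℂ) • stdVector j := by
  have h := hasSum_diagonalFunction_apply g t (stdVector j)
  have h2 := hasSum_single (f := fun k => (((1 / 2 : ℝ) ^ k * g k t : ℝ) : ℂ) •
    inner ℂ (stdVector k) (stdVector j) • stdVector k) j fun k hk => by
      simp [orthonormal_stdVector.2 hk]
  rw [h.unique h2, inner_self_eq_norm_sq_to_K, orthonormal_stdVector.1 j]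
  simp

/-- The Cuntz class of the square of a diagonal function. -/
noncomputable def diagonalClass (g : ℕ → C(X, unitInterval)) : CuC X :=
  toAntisymmetrization (· ≤ ·) ⟨star (diagonalFunction g) * diagonalFunction g, _, rfl⟩

-- If only finitely many entries are nonzero, the corresponding standard vectors span the range of
-- `D`. Conversely, `D * D` multiplies each of these vectors by a nonzero scalar, which gives
-- independent images.
open scoped Classical in
theorem rankFunction_diagonalClass (g : ℕ → C(X, unitInterval)) (t : X) :
    (rankFunction (diagonalClass g)).1 t = {k | (g k t : ℝ) ≠ 0}.encard := by
  rw [diagonalClass, rankFunction_mk]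
  set D : HilbertL2 →L[ℂ] HilbertL2 :=
    (diagonalFunction g t : HilbertL2 →L[ℂ] HilbertL2) with hD
  have hval : ((star (diagonalFunction g) * diagonalFunction g) t :
      HilbertL2 →L[ℂ] HilbertL2) = D * D :=
    congrArg (· * D) (star_diagonalFunction_apply g t)
  rw [hval]
  apply le_antisymm
  · by_cases hfin : {k | (g k t : ℝ) ≠ 0}.Finite
    · have h1 : operatorRank (D * D) ≤ operatorRank D := by
        simpa using operatorRank_mul_mul_le D D 1
      refine h1.trans ?_
      have hrange : LinearMap.range D.toLinearMap ≤
          Submodule.span ℂ ((hfin.toFinset.image stdVector : Finset HilbertL2) : Set HilbertL2) := by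
        rintro _ ⟨x, rfl⟩
        have h2 := hasSum_sum_of_ne_finset_zero (L := .unconditional ℕ) (s := hfin.toFinset) (f := fun k =>
          (((1 / 2 : ℝ) ^ k * g k t : ℝ) : ℂ) • inner ℂ (stdVector k) x • stdVector k) fun k hk => by
            have : (g k t : ℝ) = 0 := by simpa using hk
            simp [this]
        have h3 : D x = _ := (hasSum_diagonalFunction_apply g t x).unique h2
        rw [ContinuousLinearMap.coe_coe, h3]
        refine Submodule.sum_mem _ fun k hk => Submodule.smul_mem _ _ (Submodule.smul_mem _ _ ?_)
        exact Submodule.subset_span (Finset.mem_coe.2 (Finset.mem_image_of_mem _ hk))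
      have h4 : LinearMap.rank D.toLinearMap ≤ (hfin.toFinset.card : Cardinal) :=
        (Submodule.rank_mono hrange).trans ((rank_span_finset_le _).trans
          (by exact_mod_cast Finset.card_image_le))
      rw [operatorRank, hfin.encard_eq_coe_toFinset_card, ← Cardinal.toENat_nat]
      exact Cardinal.toENat.monotone' h4
    · rw [Set.encard_eq_top_iff.2 hfin]
      exact le_top
  · refine ENat.forall_natCast_le_iff_le.1 fun n hn => ?_
    obtain ⟨s, hs, hsn⟩ := Set.exists_subset_encard_eq hn
    have hsfin : s.Finite := Set.finite_of_encard_eq_coe hsn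
    have hcard : hsfin.toFinset.card = n := by
      rw [hsfin.encard_eq_coe_toFinset_card] at hsn
      exact_mod_cast hsn
    let k : Fin n ↪o ℕ := hsfin.toFinset.orderEmbOfFin hcard
    have hk (i : Fin n) : (((1 / 2 : ℝ) ^ k i * g (k i) t : ℝ) : ℂ) ≠ 0 := by
      have : (g (k i) t : ℝ) ≠ 0 :=
        hs (hsfin.mem_toFinset.1 (hsfin.toFinset.orderEmbOfFin_mem hcard i))
      exact_mod_cast mul_ne_zero (by positivity) this
    rw [natCast_le_operatorRank_iff]
    refine ⟨fun i => stdVector (k i), ?_⟩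
    have hli := ((orthonormal_stdVector.linearIndependent.comp k k.injective).units_smul
      fun i => Units.mk0 _ (mul_ne_zero (hk i) (hk i)))
    have heq : (fun i => (D * D) (stdVector (k i))) =
        (fun i => Units.mk0 _ (mul_ne_zero (hk i) (hk i))) • stdVector ∘ k := by
      funext i
      rw [mul_apply_eq_comp, diagonalFunction_apply_stdVector, map_smul,
        diagonalFunction_apply_stdVector, smul_smul]
      rfl
    rw [← heq] at hli
    exact hli

end Diagonal

/-! ### Realizing and approximating lower semicontinuous functions -/

section Realization

theorem IsClosed.exists_continuousMap_eq_zero_iff {X : Type*} [PseudoMetricSpace X] {C : Set X}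
    (hC : IsClosed C) : ∃ g : C(X, unitInterval), ∀ t, (g t : ℝ) = 0 ↔ t ∈ C := by
  rcases C.eq_empty_or_nonempty with rfl | hne
  · exact ⟨ContinuousMap.const X 1, by simp⟩
  · refine ⟨⟨fun t => projIcc 0 1 zero_le_one (Metric.infDist t C), by fun_prop⟩, fun t => ?_⟩
    rw [hC.mem_iff_infDist_zero hne, ContinuousMap.coe_mk, coe_projIcc]
    have := Metric.infDist_nonneg (x := t) (s := C)
    constructor
    · intro h
      rcases le_total (Metric.infDist t C) 1 with h1 | h1
      · rwa [min_eq_right h1, max_eq_right this] at h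
      · rw [min_eq_left h1] at h
        norm_num at h
    · intro h
      simp [h]

theorem ENat.encard_setOf_natCast_lt (m : ℕ∞) : {k : ℕ | (k : ℕ∞) < m}.encard = m := by
  induction m using ENat.recTopCoe with
  | top => simp
  | coe n =>
    have : {k : ℕ | (k : ℕ∞) < n} = (Finset.range n : Set ℕ) := by ext; simp
    rw [this, Set.encard_coe_eq_coe_finsetCard, Finset.card_range]

theorem LowerSemicontinuous.eventually_natCast_le {X : Type*} [TopologicalSpace X] {f : X → ℕ∞}
    (hf : LowerSemicontinuous f) {t : X} {n : ℕ} (h : (n : ℕ∞) ≤ f t) :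
    ∀ᶠ s in 𝓝 t, (n : ℕ∞) ≤ f s := by
  cases n with
  | zero => simp
  | succ n =>
    have h1 : (n : ℕ∞) < f t := lt_of_lt_of_le (by exact_mod_cast n.lt_succ_self) h
    filter_upwards [hf t n h1] with s hs
    rw [Nat.cast_succ]
    exact Order.add_one_le_of_lt hs

variable {X : Type*} [PseudoMetricSpace X]

/-- The open set `{f > k}` is the nonvanishing set of `g k`, so `f t` counts the nonzero entries of
the diagonal at `t`. -/
theorem exists_cozero_sequence (f : LscENat X) :
    ∃ g : ℕ → C(X, unitInterval), ∀ k t, (g k t : ℝ) = 0 ↔ f.1 t ≤ k := by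
  choose g hg using fun k : ℕ =>
    (f.2.isClosed_preimage (k : ℕ∞)).exists_continuousMap_eq_zero_iff
  exact ⟨g, hg⟩

/-- The first `n` functions of the sequence, cut down by `1 / (n + 1)`. -/
noncomputable def cutDown (g : ℕ → C(X, unitInterval)) (n k : ℕ) : C(X, unitInterval) :=
  if k < n then ⟨fun t => projIcc 0 1 zero_le_one ((g k t : ℝ) - 1 / (n + 1)), by fun_prop⟩ else 0

theorem cutDown_ne_zero_iff (g : ℕ → C(X, unitInterval)) (n k : ℕ) (t : X) :
    (cutDown g n k t : ℝ) ≠ 0 ↔ k < n ∧ 1 / ((n : ℝ) + 1) < g k t := by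
  unfold cutDown
  split_ifs with h
  · rw [ContinuousMap.coe_mk, coe_projIcc]
    simp only [h, true_and, ne_eq]
    rw [← sub_pos (b := 1 / ((n : ℝ) + 1))]
    constructor
    · intro h1
      by_contra! h2
      exact h1 (max_eq_left ((min_le_right _ _).trans h2))
    · intro h1
      exact (lt_max_of_lt_right (lt_min one_pos h1)).ne'
  · simp [h]

variable [CompactSpace X]

/-- Every lower semicontinuous function is a rank function. -/
theorem rankFunction_surjective : Function.Surjective (rankFunction : CuC X → LscENat X) := by
  intro f
  obtain ⟨g, hg⟩ := exists_cozero_sequence f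
  refine ⟨diagonalClass g, Subtype.ext (funext fun t => ?_)⟩
  rw [rankFunction_diagonalClass]
  simp only [ne_eq, hg, not_le]
  exact ENat.encard_setOf_natCast_lt _

/-- The rank of `z n` counts the `k < n` with `g k > 1/(n+1)`, and this increases to `f`. The
positive threshold provides the constant `c`: an entry vanishing at `t` stays below it near `t`. -/
theorem exists_locally_bounded_approximation (f : LscENat X) :
    ∃ z : ℕ → CuC X, Monotone (fun n => rankFunction (z n)) ∧ (∀ n, rankFunction (z n) ≤ f) ∧
      (∀ t (m : ℕ), (m : ℕ∞) ≤ f.1 t → ∃ n, (m : ℕ∞) ≤ (rankFunction (z n)).1 t) ∧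
      ∀ n t, ∃ c : ℕ, ∀ᶠ s in 𝓝 t, (rankFunction (z n)).1 s ≤ c ∧ (c : ℕ∞) ≤ f.1 s := by
  obtain ⟨g, hg⟩ := exists_cozero_sequence f
  have hz (n : ℕ) (t : X) : (rankFunction (diagonalClass (cutDown g n))).1 t =
      {k | k < n ∧ 1 / ((n : ℝ) + 1) < g k t}.encard := by
    rw [rankFunction_diagonalClass]
    simp only [cutDown_ne_zero_iff]
  refine ⟨fun n => diagonalClass (cutDown g n), fun n n' hn t => ?_, fun n t => ?_,
    fun t m hm => ?_, fun n t => ?_⟩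
  · change (rankFunction (diagonalClass (cutDown g n))).1 t ≤
      (rankFunction (diagonalClass (cutDown g n'))).1 t
    rw [hz, hz]
    refine Set.encard_le_encard fun k hk => ⟨hk.1.trans_le hn, lt_of_le_of_lt ?_ hk.2⟩
    exact one_div_le_one_div_of_le (by positivity) (by exact_mod_cast Nat.succ_le_succ hn)
  · change (rankFunction (diagonalClass (cutDown g n))).1 t ≤ f.1 t
    rw [hz, ← ENat.encard_setOf_natCast_lt (f.1 t)]
    refine Set.encard_le_encard fun k hk => ?_
    have h0 : (0 : ℝ) < 1 / ((n : ℝ) + 1) := by positivity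
    exact not_le.1 fun h => (h0.trans hk.2).ne' ((hg k t).2 h)
  · have hev : ∀ᶠ n : ℕ in atTop, ∀ k ∈ Finset.range m, 1 / ((n : ℝ) + 1) < g k t := by
      rw [eventually_all_finset]
      intro k hk
      have hpos : (0 : ℝ) < g k t := by
        refine lt_of_le_of_ne (g k t).2.1 (Ne.symm fun h => ?_)
        have h1 := hm.trans ((hg k t).1 h)
        exact absurd (Finset.mem_range.1 hk) (not_lt.2 (by exact_mod_cast h1))
      exact tendsto_one_div_add_atTop_nhds_zero_nat.eventually (gt_mem_nhds hpos)
    obtain ⟨n, hn, hmn⟩ := (hev.and (eventually_ge_atTop m)).exists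
    refine ⟨n, ?_⟩
    rw [hz, ← Finset.card_range m, ← Set.encard_coe_eq_coe_finsetCard]
    exact Set.encard_le_encard fun k hk =>
      ⟨(Finset.mem_range.1 hk).trans_le hmn, hn k hk⟩
  -- The constant is `c = min n (f t)`. Indices in `[c, n)` have `g k t = 0` and are not counted
  -- near `t`, while `f ≥ c` persists by lower semicontinuity.
  · obtain ⟨c, hc⟩ : ∃ c : ℕ, (c : ℕ∞) = min (n : ℕ∞) (f.1 t) :=
      ENat.ne_top_iff_exists.1 (ne_top_of_le_ne_top (ENat.natCast_ne_top n) (min_le_left _ _))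
    have hev : ∀ᶠ s in 𝓝 t, ∀ k ∈ Finset.Ico c n, (g k s : ℝ) < 1 / ((n : ℝ) + 1) := by
      rw [eventually_all_finset]
      intro k hk
      rw [Finset.mem_Ico] at hk
      have hk0 : (g k t : ℝ) = 0 := by
        rw [hg]
        have h1 : min (n : ℕ∞) (f.1 t) ≤ k := by rw [← hc]; exact_mod_cast hk.1
        exact (min_le_iff.1 h1).resolve_left (not_le.2 (by exact_mod_cast hk.2))
      have hcont : Continuous fun s => (g k s : ℝ) := by fun_prop
      refine hcont.continuousAt.eventually (gt_mem_nhds ?_)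
      change (g k t : ℝ) < _
      rw [hk0]
      positivity
    refine ⟨c, ?_⟩
    filter_upwards [hev, f.2.eventually_natCast_le (hc.le.trans (min_le_right _ _))] with s hs hs'
    refine ⟨?_, hs'⟩
    rw [hz, ← Finset.card_range c, ← Set.encard_coe_eq_coe_finsetCard]
    refine Set.encard_le_encard fun k hk => ?_
    rw [Finset.mem_coe, Finset.mem_range]
    by_contra! hck
    exact lt_asymm hk.2 (hs k (Finset.mem_Ico.2 ⟨hck, hk.1⟩))

end Realization

/-! ### Compact containment in terms of rank functions -/

section Main

theorem CompactlyContained.of_le_of_le {S : Type*} [PartialOrder S] {x x' y y' : S}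
    (hx : x ≤ x') (h : CompactlyContained x' y') (hy : y' ≤ y) : CompactlyContained x y := by
  intro z s hz hs hys
  obtain ⟨n, hn⟩ := h z s hz hs (hy.trans hys)
  exact ⟨n, hx.trans hn⟩

theorem exists_locally_between_of_compactlyContained {x y : CuC unitInterval}
    (h : CompactlyContained x y) (t : unitInterval) :
    ∃ c : ℕ, ∀ᶠ s in 𝓝 t, (rankFunction x).1 s ≤ c ∧ (c : ℕ∞) ≤ (rankFunction y).1 s := by
  obtain ⟨z, hz, hle, hsup, hloc⟩ := exists_locally_bounded_approximation (rankFunction y)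
  obtain ⟨n, hn⟩ := h z y (fun n n' hn => rankFunction_le_iff.1 (hz hn))
    ⟨by rintro _ ⟨n, rfl⟩; exact rankFunction_le_iff.1 (hle n), fun w hw => by
      refine rankFunction_le_iff.1 fun t => ENat.forall_natCast_le_iff_le.1 fun m hm => ?_
      obtain ⟨n, hn⟩ := hsup t m hm
      exact hn.trans (rankFunction_le_iff.2 (hw (mem_range_self n)) t)⟩ le_rfl
  obtain ⟨c, hc⟩ := hloc n t
  refine ⟨c, hc.mono fun s hs => ⟨(rankFunction_le_iff.2 hn s).trans hs.1, hs.2⟩⟩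

/-- The pointwise supremum is lower semicontinuous, hence is the rank function of an upper bound. -/
theorem rankFunction_le_iSup {z : ℕ → CuC unitInterval} {w : CuC unitInterval}
    (hw : IsLUB (range z) w) (t : unitInterval) :
    (rankFunction w).1 t ≤ ⨆ n, (rankFunction (z n)).1 t := by
  obtain ⟨v, hv⟩ := rankFunction_surjective (X := unitInterval)
    ⟨fun t => ⨆ n, (rankFunction (z n)).1 t,
      lowerSemicontinuous_iSup fun n => (rankFunction (z n)).2⟩
  have hwv : w ≤ v := hw.2 (by
    rintro _ ⟨n, rfl⟩
    refine rankFunction_le_iff.1 fun t => ?_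
    rw [hv]
    exact le_iSup (fun n => (rankFunction (z n)).1 t) n)
  have := rankFunction_le_iff.2 hwv t
  rwa [hv] at this

/-- An integer `c` below the supremum of the ranks at `t` is reached by some `z n`, and lower
semicontinuity keeps it reached near `t`. A finite subcover and monotonicity give one index for all
points. -/
theorem compactlyContained_of_locally_between {x y : CuC unitInterval}
    (h : ∀ t, ∃ c : ℕ, ∀ᶠ s in 𝓝 t,
      (rankFunction x).1 s ≤ c ∧ (c : ℕ∞) ≤ (rankFunction y).1 s) : CompactlyContained x y := by
  intro z w hz hw hyw
  have key (t : unitInterval) :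
      ∃ n, ∀ᶠ s in 𝓝 t, (rankFunction x).1 s ≤ (rankFunction (z n)).1 s := by
    obtain ⟨c, hc⟩ := h t
    obtain ⟨n, hn⟩ : ∃ n, (c : ℕ∞) ≤ (rankFunction (z n)).1 t := by
      cases c with
      | zero => exact ⟨0, by simp⟩
      | succ c =>
        have h1 := (hc.self_of_nhds.2.trans (rankFunction_le_iff.2 hyw t)).trans
          (rankFunction_le_iSup hw t)
        have h2 : (c : ℕ∞) < ⨆ n, (rankFunction (z n)).1 t :=
          lt_of_lt_of_le (by exact_mod_cast c.lt_succ_self) h1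
        obtain ⟨n, hn⟩ := lt_iSup_iff.1 h2
        refine ⟨n, ?_⟩
        rw [Nat.cast_succ]
        exact Order.add_one_le_of_lt hn
    refine ⟨n, ?_⟩
    filter_upwards [hc, (rankFunction (z n)).2.eventually_natCast_le hn] with s hs hs'
    exact hs.1.trans hs'
  choose n hn using key
  obtain ⟨T, hT⟩ := isCompact_univ.elim_nhds_subcover _ fun t _ => hn t
  refine ⟨T.sup n, rankFunction_le_iff.1 fun s => ?_⟩
  obtain ⟨t, ht, hs⟩ := mem_iUnion₂.1 (hT.2 (mem_univ s))
  exact le_trans hs (rankFunction_le_iff.2 (hz (Finset.le_sup ht)) s)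

/-- The admissible values at each point form a convex set and constants are local solutions, so a
partition of unity glues them. -/
theorem exists_liesBetween_of_locally_between {x y : CuC unitInterval}
    (h : ∀ t, ∃ c : ℕ, ∀ᶠ s in 𝓝 t,
      (rankFunction x).1 s ≤ c ∧ (c : ℕ∞) ≤ (rankFunction y).1 s) :
    ∃ g : unitInterval → NNReal, LiesBetween x y g := by
  obtain ⟨g, hg⟩ := exists_continuous_forall_mem_convex_of_local_const (X := unitInterval) (E := ℝ)
    (t := fun t => {r : ℝ | ((rankFunction x).1 t : ENNReal) ≤ ENNReal.ofReal r ∧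
      ENNReal.ofReal r ≤ ((rankFunction y).1 t : ENNReal)})
    (fun t => OrdConnected.convex ⟨fun r hr r' hr' q hq =>
      ⟨hr.1.trans (ENNReal.ofReal_le_ofReal hq.1), (ENNReal.ofReal_le_ofReal hq.2).trans hr'.2⟩⟩)
    (fun t => by
      obtain ⟨c, hc⟩ := h t
      refine ⟨c, hc.mono fun s hs => ?_⟩
      change _ ≤ ENNReal.ofReal c ∧ ENNReal.ofReal c ≤ _
      rw [ENNReal.ofReal_natCast, ← ENat.toENNReal_coe, ENat.toENNReal_le, ENat.toENNReal_le]
      exact hs)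
  exact ⟨fun t => (g t).toNNReal, by fun_prop, hg⟩

theorem locally_between_of_liesBetween {x y : CuC unitInterval} {g : unitInterval → NNReal}
    (hg : LiesBetween x y g) (t : unitInterval) :
    ∃ c : ℕ, ∀ᶠ s in 𝓝 t, (rankFunction x).1 s ≤ c ∧ (c : ℕ∞) ≤ (rankFunction y).1 s := by
  -- Near `t`, `g < ⌊g t⌋ + 1`, so the integer rank of `x` is at most `⌊g t⌋`. The rank of `y` is at
  -- least `⌊g t⌋` at `t`, hence nearby.
  refine ⟨⌊g t⌋₊, ?_⟩
  have h1 : ((⌊g t⌋₊ : ℕ) : ℕ∞) ≤ (rankFunction y).1 t := by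
    rw [← ENat.toENNReal_le, ENat.toENNReal_coe]
    refine le_trans ?_ (hg.2 t).2
    exact_mod_cast Nat.floor_le (zero_le (a := g t))
  have h2 : ∀ᶠ s in 𝓝 t, g s < ⌊g t⌋₊ + 1 :=
    hg.1.continuousAt.eventually (gt_mem_nhds (Nat.lt_floor_add_one (g t)))
  filter_upwards [h2, (rankFunction y).2.eventually_natCast_le h1] with s hs hs'
  refine ⟨?_, hs'⟩
  rw [← ENat.lt_add_one_iff (ENat.natCast_ne_top _), ← ENat.toENNReal_lt]
  refine lt_of_le_of_lt (hg.2 s).1 ?_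
  push_cast
  exact_mod_cast hs

theorem exists_Ioo_of_eventually_nhds {t : unitInterval} {p : unitInterval → Prop}
    (h : ∀ᶠ s in 𝓝 t, p s) :
    ∃ a b : ℝ, (t : ℝ) ∈ Ioo a b ∧ ∀ s : unitInterval, (s : ℝ) ∈ Ioo a b → p s := by
  obtain ⟨ε, hε, hball⟩ := Metric.eventually_nhds_iff.1 h
  refine ⟨t - ε, t + ε, ⟨by linarith, by linarith⟩, fun s hs => hball ?_⟩
  rw [Subtype.dist_eq, Real.dist_eq, abs_lt]
  exact ⟨by linarith [hs.1], by linarith [hs.2]⟩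

theorem eventually_nhds_of_Ioo {t : unitInterval} {p : unitInterval → Prop} {a b : ℝ}
    (ht : (t : ℝ) ∈ Ioo a b) (h : ∀ s : unitInterval, (s : ℝ) ∈ Ioo a b → p s) :
    ∀ᶠ s in 𝓝 t, p s :=
  (continuous_subtype_val.continuousAt.eventually (Ioo_mem_nhds ht.1 ht.2)).mono h

/-- The points where `g < f` form an open set. -/
theorem LowerSemicontinuous.eventually_lt_toENNReal {X : Type*} [TopologicalSpace X] {f : X → ℕ∞}
    (hf : LowerSemicontinuous f) {g : X → NNReal} (hg : Continuous g) {t : X}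
    (h : (g t : ENNReal) < (f t : ENNReal)) : ∀ᶠ s in 𝓝 t, (g s : ENNReal) < (f s : ENNReal) := by
  obtain ⟨m, hgm, hmf⟩ : ∃ m : ℕ, g t < m ∧ (m : ℕ∞) ≤ f t := by
    rcases eq_or_ne (f t) ⊤ with h' | h'
    · obtain ⟨m, hm⟩ := exists_nat_gt (g t)
      exact ⟨m, hm, by simp [h']⟩
    · obtain ⟨m, hm⟩ := ENat.ne_top_iff_exists.1 h'
      refine ⟨m, ?_, hm.le⟩
      rw [← hm, ENat.toENNReal_coe] at h
      exact_mod_cast h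
  filter_upwards [hg.continuousAt.eventually (gt_mem_nhds hgm), hf.eventually_natCast_le hmf]
    with s hs hs'
  refine lt_of_lt_of_le ?_ (ENat.toENNReal_le.2 hs')
  rw [ENat.toENNReal_coe]
  exact_mod_cast hs

end Main

theorem mainTheorem2 (x y : CuC unitInterval) :
    List.TFAE [
      CompactlyContained x y,
      ∀ t : unitInterval, ∃ a b : ℝ, (t : ℝ) ∈ Ioo a b ∧ ∃ c : ℕ,
        ∀ s : unitInterval, (s : ℝ) ∈ Ioo a b →
          (rankFunction x).1 s ≤ (c : ℕ∞) ∧ (c : ℕ∞) ≤ (rankFunction y).1 s,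
      ∃ g : unitInterval → NNReal, LiesBetween x y g] ∧
    ((IsSeqCompactElement x ∨ IsSeqCompactElement y) →
      (CompactlyContained x y ↔ rankFunction x ≤ rankFunction y)) ∧
    (¬ IsSeqCompactElement y → CompactlyContained x y →
      (∃ g : unitInterval → NNReal, LiesBetween x y g) ∧
      ∀ g : unitInterval → NNReal, LiesBetween x y g →
        ∃ a b : ℝ, a < b ∧ Ioo a b ⊆ Icc 0 1 ∧
          ∀ t : unitInterval, (t : ℝ) ∈ Ioo a b →
            ((rankFunction x).1 t : ENNReal) ≤ (g t : ENNReal) ∧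
              (g t : ENNReal) < ((rankFunction y).1 t : ENNReal)) := by
  have h12 (x y : CuC unitInterval) (h : CompactlyContained x y) :=
    exists_locally_between_of_compactlyContained h
  refine ⟨?_, fun hc => ⟨fun h => ?_, fun h => ?_⟩, fun hy h =>
    ⟨exists_liesBetween_of_locally_between (h12 x y h), fun g hg => ?_⟩⟩
  · tfae_have 1 → 2 := by
      intro h t
      obtain ⟨c, hc⟩ := h12 x y h t
      obtain ⟨a, b, ht, hab⟩ := exists_Ioo_of_eventually_nhds hc
      exact ⟨a, b, ht, c, hab⟩
    tfae_have 2 → 3 := by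
      refine fun h => exists_liesBetween_of_locally_between fun t => ?_
      obtain ⟨a, b, ht, c, hc⟩ := h t
      exact ⟨c, eventually_nhds_of_Ioo ht hc⟩
    tfae_have 3 → 1 := fun ⟨g, hg⟩ =>
      compactlyContained_of_locally_between (locally_between_of_liesBetween hg)
    tfae_finish
  · intro t
    obtain ⟨c, hc⟩ := h12 x y h t
    exact hc.self_of_nhds.1.trans hc.self_of_nhds.2
  · have hxy := rankFunction_le_iff.1 h
    rcases hc with hc | hc
    · exact CompactlyContained.of_le_of_le le_rfl hc hxy
    · exact CompactlyContained.of_le_of_le hxy hc le_rfl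
  -- Otherwise `g` equals the rank function of `y` everywhere, so it lies between `y` and `y` and
  -- makes `y` compact.
  · obtain ⟨t, ht⟩ : ∃ t, (g t : ENNReal) < ((rankFunction y).1 t : ENNReal) := by
      by_contra! hall
      exact hy (compactlyContained_of_locally_between
        (locally_between_of_liesBetween ⟨hg.1, fun t => ⟨hall t, (hg.2 t).2⟩⟩))
    obtain ⟨a, b, hab, hlt⟩ := exists_Ioo_of_eventually_nhds
      ((rankFunction y).2.eventually_lt_toENNReal hg.1 ht)
    -- Truncation keeps the interval inside `[0,1]`. It remains nonempty even when `t` is an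
    -- endpoint.
    refine ⟨max a 0, min b 1, ?_, fun s hs => ?_, fun s hs => ⟨(hg.2 s).1, hlt s ?_⟩⟩
    · rw [max_lt_iff, lt_min_iff, lt_min_iff]
      exact ⟨⟨hab.1.trans hab.2, hab.1.trans_le t.2.2⟩, t.2.1.trans_lt hab.2, one_pos⟩
    · exact ⟨(le_max_right _ _).trans hs.1.le, hs.2.le.trans (min_le_right _ _)⟩
    · exact ⟨(le_max_left _ _).trans_lt hs.1, hs.2.trans_le (min_le_left _ _)⟩
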